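/- Let $R$ be a commutative noetherian ring and let $\mathcal D^+(R\text{-Mod})$ be the derived category of left-bounded complexes of $R$-modules, in which every $R$-module is regarded as a complex concentrated in degree $0$. For a functor $\delta$ from $\mathcal D^+(R\text{-Mod})$ to itself let $\operatorname{Im}(\delta)$ be the full subcategory of objects isomorphic to $\delta(X)$ for some $X$, and $\operatorname{Ker}(\delta)$ the full subcategory of objects $X$ with $\delta(X)\cong 0$. A functor $\delta:\mathcal D^+(R\text{-Mod})\to\mathcal D^+(R\text{-Mod})$ is called an abstract local cohomology functor if (0) $\delta$ is a triangle functor, i.e. it is additive, commutes with the shift and sends distinguished triangles to distinguished triangles; (1) the inclusion $i:\operatorname{Im}(\delta)\to\mathcal D^+(R\text{-Mod})$ has a right adjoint $\rho$, and $\delta\cong i\circ\rho$; (2) every indecomposable injective $R$-module belongs to $\operatorname{Im}(\delta)$ or to $\operatorname{Ker}(\delta)$. For $W\subseteq\operatorname{Spec}(R)$ let $\varGamma_W$ be the section functor $\varGamma_W(M)=\{x\in M\mid \operatorname{Supp}(Rx)\subseteq W\}$ on $R$-modules, and $\mathbf R\varGamma_W:\mathcal D^+(R\text{-Mod})\to\mathcal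 D^+(R\text{-Mod})$ its right derived functor. **Theorem.** Let $\delta$ be an abstract local cohomology functor on $\mathcal D^+(R\text{-Mod})$. Then there is a specialization-closed subset $W\subseteq\operatorname{Spec}(R)$ (that is, $\mathfrak p\in W$ and $\mathfrak p\subseteq\mathfrak q\in\operatorname{Spec}(R)$ imply $\mathfrak q\in W$) such that $\delta$ is isomorphic to $\mathbf R\varGamma_W$. More precisely, one can take $$W=\{\mathfrak p\in\operatorname{Spec}(R)\mid E_R(R/\mathfrak p)\in\operatorname{Im}(\delta)\},$$ where $E_R(R/\mathfrak p)$ is the injective hull of $R/\mathfrak p$. -/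

import Mathlib

open CategoryTheory

universe w u

namespace AbstractLocalCohomology

section SectionFunctor

variable {R : Type u} [CommRing R]

/-- The support of a cyclic module generated by a sum. -/
lemma support_span_add_subset {M : Type u} [AddCommGroup M] [Module R M] (x y : M) :
    Module.support R (Submodule.span R {x + y}) ⊆
      Module.support R (Submodule.span R {x}) ∪ Module.support R (Submodule.span R {y}) := by
  intro p hp
  by_contra h
  simp only [Set.mem_union, not_or] at h
  obtain ⟨hx, hy⟩ := h
  rw [Module.notMem_support_iff'] at hx hy
  obtain ⟨r, hr, hrx⟩ := hx ⟨x, Submodule.mem_span_singleton_self x⟩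
  obtain ⟨s, hs, hsy⟩ := hy ⟨y, Submodule.mem_span_singleton_self y⟩
  have hrx' : r • x = 0 := congrArg Subtype.val hrx
  have hsy' : s • y = 0 := congrArg Subtype.val hsy
  refine (Module.notMem_support_iff'.mpr ?_) hp
  rintro ⟨m, hm⟩
  obtain ⟨a, rfl⟩ := Submodule.mem_span_singleton.mp hm
  refine ⟨r * s, fun hrs => (p.2.mem_or_mem hrs).elim hr hs, Subtype.ext ?_⟩
  change (r * s) • a • (x + y) = 0
  have h1 : (r * s) • a • x = 0 := by
    rw [show (r * s) • a • x = (s * a) • r • x by simp only [smul_smul]; congr 1; ring, hrx',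
      smul_zero]
  have h2 : (r * s) • a • y = 0 := by
    rw [show (r * s) • a • y = (r * a) • s • y by simp only [smul_smul]; congr 1; ring, hsy',
      smul_zero]
  rw [smul_add, smul_add, h1, h2, add_zero]

/-- The support of the cyclic module generated by the image of an element. -/
lemma support_span_map_subset {M N : Type u} [AddCommGroup M] [Module R M]
    [AddCommGroup N] [Module R N] (f : M →ₗ[R] N) (x : M) :
    Module.support R (Submodule.span R {f x}) ⊆ Module.support R (Submodule.span R {x}) := by
  intro p hp
  by_contra h
  rw [Module.notMem_support_iff'] at h
  obtain ⟨r, hr, hrx⟩ := h ⟨x, Submodule.mem_span_singleton_self x⟩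
  have hrx' : r • x = 0 := congrArg Subtype.val hrx
  refine (Module.notMem_support_iff'.mpr ?_) hp
  rintro ⟨m, hm⟩
  obtain ⟨a, rfl⟩ := Submodule.mem_span_singleton.mp hm
  refine ⟨r, hr, Subtype.ext ?_⟩
  change r • a • f x = 0
  rw [smul_comm, ← map_smul, hrx', map_zero, smul_zero]

/-- The submodule `Γ_W(M) = {x ∈ M | Supp(Rx) ⊆ W}` of sections with support in `W`. -/
def sectionSubmodule (W : Set (PrimeSpectrum R)) (M : Type u) [AddCommGroup M] [Module R M] :
    Submodule R M where
  carrier := {x | Module.support R (Submodule.span R {x}) ⊆ W}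
  zero_mem' := by
    intro p hp
    rw [Submodule.span_zero_singleton, Module.support_eq_empty] at hp
    exact hp.elim
  add_mem' := fun {x y} hx hy =>
    (support_span_add_subset x y).trans (Set.union_subset hx hy)
  smul_mem' := fun a x hx =>
    (support_span_map_subset (LinearMap.lsmul R M a) x).trans hx

/-- The section functor `Γ_W` with support in `W`: a subfunctor of the identity functor,
acting on morphisms by restriction. -/
def sectionFunctor (W : Set (PrimeSpectrum R)) : ModuleCat.{u} R ⥤ ModuleCat.{u} R where
  obj M := ModuleCat.of R (sectionSubmodule W M)
  map f := ModuleCat.ofHom (f.hom.restrict fun x hx => (support_span_map_subset f.hom x).trans hx)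

instance (W : Set (PrimeSpectrum R)) : (sectionFunctor W).Additive where

end SectionFunctor

section Derived

variable {R : Type u} [CommRing R] [HasDerivedCategory.{w} (ModuleCat.{u} R)]

/-- The right derived functor `RΓ_W : D⁺(R-Mod) ⥤ D⁺(R-Mod)` of the section functor. -/
noncomputable def derivedSectionFunctor (W : Set (PrimeSpectrum R)) :
    DerivedCategory.Plus (ModuleCat.{u} R) ⥤ DerivedCategory.Plus (ModuleCat.{u} R) :=
  (sectionFunctor W).rightDerivedFunctorPlus

/-- An `R`-module, regarded as a complex concentrated in degree zero. -/
noncomputable def ofModule (M : ModuleCat.{u} R) : DerivedCategory.Plus (ModuleCat.{u} R) :=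
  (DerivedCategory.Plus.singleFunctor (ModuleCat.{u} R) 0).obj M

variable (δ : DerivedCategory.Plus (ModuleCat.{u} R) ⥤ DerivedCategory.Plus (ModuleCat.{u} R))

/-- `δ` is a triangle functor: it is additive, commutes with the shift, and sends distinguished
triangles to distinguished triangles. -/
def IsTriangleFunctor : Prop :=
  δ.Additive ∧ ∃ _ : δ.CommShift ℤ, δ.IsTriangulated

/-- The full subcategory `Im δ` of objects isomorphic to some `δ X`. -/
def im : ObjectProperty (DerivedCategory.Plus (ModuleCat.{u} R)) := δ.essImage

/-- The full subcategory `Ker δ` of objects `X` with `δ X ≅ 0`. -/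
def ker : ObjectProperty (DerivedCategory.Plus (ModuleCat.{u} R)) :=
  fun X => Limits.IsZero (δ.obj X)

/-- Abstract local cohomology functors on `D⁺(R-Mod)`. -/
structure IsAbstractLocalCohomologyFunctor : Prop where
  isTriangleFunctor : IsTriangleFunctor δ
  /-- The inclusion `i : Im δ ⥤ D⁺(R-Mod)` has a right adjoint `ρ`, and `δ ≅ i ∘ ρ`. -/
  exists_rightAdjoint :
    ∃ ρ : DerivedCategory.Plus (ModuleCat.{u} R) ⥤ (im δ).FullSubcategory,
      Nonempty ((im δ).ι ⊣ ρ) ∧ Nonempty (δ ≅ ρ ⋙ (im δ).ι)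
  /-- Every indecomposable injective module belongs to `Im δ` or to `Ker δ`. -/
  divides : ∀ E : ModuleCat.{u} R, Injective E → Indecomposable E →
    im δ (ofModule E) ∨ ker δ (ofModule E)

end Derived

/-- The linear map `f : M → E` exhibits `E` as an injective hull of `M`: `E` is injective, `f` is
injective, and every nonzero submodule of `E` meets the image of `f` nontrivially. -/
structure IsInjectiveHull {R : Type u} [CommRing R] {M : Type u} [AddCommGroup M] [Module R M]
    {E : ModuleCat.{u} R} (f : M →ₗ[R] E) : Prop where
  injective_module : Injective E
  injective_map : Function.Injective f
  essential : ∀ N : Submodule R E, N ⊓ LinearMap.range f = ⊥ → N = ⊥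

end AbstractLocalCohomology

/-! Write `Im` and `Ker` for the two subcategories attached to δ. Since δ is the coreflection onto
`Im`, its counit ε puts every X in a triangle δX → X → C with C in `Ker`, and each subcategory is an
orthogonal of the other: `Ker` is what receives no nonzero map from `Im`, and `Im` is what has no
nonzero map to `Ker`. Hence it suffices that RΓ_W X → X has source in `Im` and cone in `Ker`
(`IsCoreflection.nonempty_iso`).

The key point is that `Im` consists exactly of the objects with cohomology supported in W. One
inclusion is detection by injective hulls (`IsCoreflection.hasSupportIn`): a prime q ∉ W in the
support of H^j(X) gives a nonzero map H^j(X) → E(R/q), which is induced by some X → E(R/q)[-j]. As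
E(R/q) is indecomposable and not in `Im`, it lies in `Ker`, so X is not in `Im`.

Conversely, by Matlis an injective module supported in W is a direct sum of hulls E(R/p) with p ∈ W,
and it lies in `Im` because `Im` is a left orthogonal (`IsCoreflection.essImage_single`). A general
X supported in W is handled by killing cohomology from below with such injectives, which yields
triangles Y_n → X → C_n with C_n in `Im` and Y_n in degrees ≥ a + n
(`IsCoreflection.exists_approximation`). To conclude, δ(Y_n) must also move off to infinity,
although no bound on δ is assumed. The bound is automatic: all Y_n[n] are retracts of one bounded
below object P, and δP is bounded below.

Finally, over a noetherian ring Γ_W preserves injectives, by Artin–Rees. For a complex K of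
injectives, Γ_W K has terms supported in W, while K/Γ_W K is a complex of injectives without
W-sections. The latter receives no nonzero map from objects supported in W (`HasSupportIn.eq_zero`),
so it lies in `Ker`. -/

namespace AbstractLocalCohomology

/-! ### Sections with support, and injective hulls -/

section Modules

variable {R : Type u} [CommRing R]

lemma mem_sectionSubmodule_iff {W : Set (PrimeSpectrum R)} {M : Type u} [AddCommGroup M]
    [Module R M] {x : M} :
    x ∈ sectionSubmodule W M ↔ ∀ p ∉ W, ∃ r ∉ p.asIdeal, r • x = 0 := by
  change Module.support R (Submodule.span R {x}) ⊆ W ↔ _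
  constructor
  · intro h p hp
    obtain ⟨r, hr, hx⟩ := Module.notMem_support_iff'.mp (fun hp' => hp (h hp'))
      ⟨x, Submodule.mem_span_singleton_self x⟩
    exact ⟨r, hr, congrArg Subtype.val hx⟩
  · intro h p
    contrapose!
    intro hp
    obtain ⟨r, hr, hx⟩ := h p hp
    refine Module.notMem_support_iff'.mpr ?_
    rintro ⟨m, hm⟩
    obtain ⟨a, rfl⟩ := Submodule.mem_span_singleton.mp hm
    refine ⟨r, hr, Subtype.ext ?_⟩
    change r • a • x = 0
    rw [smul_comm, hx, smul_zero]

lemma support_subset_iff {W : Set (PrimeSpectrum R)} {M : Type u} [AddCommGroup M]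
    [Module R M] : Module.support R M ⊆ W ↔ ∀ x : M, x ∈ sectionSubmodule W M := by
  simp only [mem_sectionSubmodule_iff]
  constructor
  · intro h x p hp
    exact Module.notMem_support_iff'.mp (fun hp' => hp (h hp')) x
  · intro h p
    contrapose!
    exact fun hp => Module.notMem_support_iff'.mpr fun x => h x p hp

lemma support_sectionSubmodule_subset (W : Set (PrimeSpectrum R)) (M : Type u) [AddCommGroup M]
    [Module R M] : Module.support R (sectionSubmodule W M) ⊆ W := by
  refine support_subset_iff.mpr fun x => mem_sectionSubmodule_iff.mpr fun p hp => ?_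
  obtain ⟨r, hr, hx⟩ := mem_sectionSubmodule_iff.mp x.2 p hp
  exact ⟨r, hr, Subtype.ext hx⟩

lemma map_mem_sectionSubmodule {W : Set (PrimeSpectrum R)} {M N : Type u} [AddCommGroup M]
    [Module R M] [AddCommGroup N] [Module R N] (f : M →ₗ[R] N)
    (hM : Module.support R M ⊆ W) (x : M) : f x ∈ sectionSubmodule W N :=
  (support_span_map_subset f x).trans (support_subset_iff.mp hM x)

lemma eq_zero_of_support_subset {W : Set (PrimeSpectrum R)} {M N : Type u} [AddCommGroup M]
    [Module R M] [AddCommGroup N] [Module R N] (f : M →ₗ[R] N)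
    (hM : Module.support R M ⊆ W) (hN : sectionSubmodule W N = ⊥) : f = 0 := by
  ext x
  have := map_mem_sectionSubmodule f hM x
  rwa [hN, Submodule.mem_bot] at this

lemma support_subset_of_exact_at {M N P : Type u} [AddCommGroup M] [Module R M] [AddCommGroup N]
    [Module R N] [AddCommGroup P] [Module R P] {W : Set (PrimeSpectrum R)} {f : M →ₗ[R] N}
    {g : N →ₗ[R] P} (h : ∀ x, g x = 0 → ∃ y, f y = x)
    (hM : Module.support R M ⊆ W) (hP : Module.support R P ⊆ W) : Module.support R N ⊆ W := by
  refine support_subset_iff.mpr fun x => mem_sectionSubmodule_iff.mpr fun p hp => ?_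
  obtain ⟨r, hr, hx⟩ := mem_sectionSubmodule_iff.mp (support_subset_iff.mp hP (g x)) p hp
  rw [← map_smul] at hx
  obtain ⟨y, hy⟩ := h _ hx
  obtain ⟨s, hs, hy'⟩ := mem_sectionSubmodule_iff.mp (support_subset_iff.mp hM y) p hp
  refine ⟨s * r, p.asIdeal.primeCompl.mul_mem hs hr, ?_⟩
  rw [mul_smul, ← hy, ← map_smul, hy', map_zero]

/-- Over a noetherian ring, the sections with support in `W` of an injective module form an
injective module. -/
lemma sectionSubmodule_injective [IsNoetherianRing R] (W : Set (PrimeSpectrum R)) (I : Type u)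
    [AddCommGroup I] [Module R I] [hI : Module.Injective R I] :
    Module.Injective R (sectionSubmodule W I) := by
  refine Module.Baer.injective fun J g => ?_
  let N := LinearMap.range g
  have hN : Module.support R N ⊆ W :=
    (Module.support_subset_of_injective N.subtype N.injective_subtype).trans
      (support_sectionSubmodule_subset W I)
  obtain ⟨φ, hφ⟩ := (Module.Baer.of_injective hI) J ((sectionSubmodule W I).subtype ∘ₗ g)
  let X := Submodule.span R {φ 1}
  have hφ1 (r : R) : φ r = r • φ 1 := by rw [← map_smul, smul_eq_mul, mul_one]
  let Y : Submodule R X := (N.map (sectionSubmodule W I).subtype).comap X.subtype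
  -- Artin–Rees: since `𝔞` kills `N ≅ Y`, the submodule `𝔞 ^ (k + 1) X` meets `Y` trivially for a
  -- suitable `k`. So `Y` embeds in `X / 𝔞 ^ (k + 1) X`, which is supported on V(𝔞) = Supp N ⊆ W;
  -- every map from it to `I` therefore lands in the sections.
  let 𝔞 := Module.annihilator R N
  obtain ⟨k, hk⟩ := Ideal.exists_pow_inf_eq_pow_smul 𝔞 Y
  have hbot : 𝔞 ^ (k + 1) • (⊤ : Submodule R X) ⊓ Y = ⊥ := by
    rw [hk (k + 1) (by omega), eq_bot_iff]
    refine (Submodule.smul_mono le_rfl inf_le_right).trans ?_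
    rw [Nat.add_sub_cancel_left, pow_one, Submodule.smul_le]
    rintro r hr y hy
    obtain ⟨z, hz, hzy⟩ := hy
    have : r • (⟨z, hz⟩ : N) = 0 := Module.mem_annihilator.mp hr _
    have h0 : r • z = 0 := congrArg Subtype.val this
    rw [Submodule.mem_bot]
    apply Subtype.ext
    change r • X.subtype y = 0
    rw [← hzy, ← map_smul, h0, map_zero]
  let Z := X ⧸ (𝔞 ^ (k + 1) • (⊤ : Submodule R X))
  have hZ : Module.support R Z ⊆ W := by
    rw [Module.support_eq_zeroLocus]
    intro p hp
    refine hN ?_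
    rw [Module.support_eq_zeroLocus, PrimeSpectrum.mem_zeroLocus]
    have hle : 𝔞 ^ (k + 1) ≤ Module.annihilator R Z := by
      intro r hr
      rw [Module.mem_annihilator]
      intro z
      obtain ⟨x, rfl⟩ := Submodule.Quotient.mk_surjective _ z
      rw [← Submodule.Quotient.mk_smul, Submodule.Quotient.mk_eq_zero]
      exact Submodule.smul_mem_smul hr trivial
    exact p.2.le_of_pow_le (hle.trans hp)
  let i : Y →ₗ[R] Z := (𝔞 ^ (k + 1) • (⊤ : Submodule R X)).mkQ ∘ₗ Y.subtype
  have hi : Function.Injective i := by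
    rw [injective_iff_map_eq_zero]
    intro y hy
    have h1 : (y : X) ∈ 𝔞 ^ (k + 1) • (⊤ : Submodule R X) :=
      (Submodule.Quotient.mk_eq_zero _).mp hy
    have h2 : (y : X) ∈ (⊥ : Submodule R X) := hbot ▸ ⟨h1, y.2⟩
    exact Subtype.ext h2
  obtain ⟨ψ, hψ⟩ := Module.Injective.extension_property R I Y Z i hi (X.subtype ∘ₗ Y.subtype)
  let θ : Z →ₗ[R] sectionSubmodule W I := ψ.codRestrict _ (map_mem_sectionSubmodule ψ hZ)
  let one : X := ⟨φ 1, Submodule.mem_span_singleton_self _⟩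
  refine ⟨θ ∘ₗ (𝔞 ^ (k + 1) • (⊤ : Submodule R X)).mkQ ∘ₗ LinearMap.toSpanSingleton R X one,
    fun x hx => Subtype.ext ?_⟩
  have hx1 : x • φ 1 = g ⟨x, hx⟩ := by rw [← hφ1, hφ x hx]; rfl
  have hxY : x • one ∈ Y := ⟨g ⟨x, hx⟩, ⟨_, rfl⟩, hx1.symm⟩
  have := LinearMap.congr_fun hψ ⟨x • one, hxY⟩
  exact this.trans hx1

lemma injective_of_retract {M N : Type u} [AddCommGroup M] [Module R M] [AddCommGroup N]
    [Module R N] [Module.Injective R N] (i : M →ₗ[R] N) (r : N →ₗ[R] M)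
    (h : ∀ x, r (i x) = x) : Module.Injective R M where
  out X Y _ _ _ _ f hf g := by
    obtain ⟨k, hk⟩ := Module.Injective.extension_property R N X Y f hf (i ∘ₗ g)
    refine ⟨r ∘ₗ k, fun x => ?_⟩
    have := LinearMap.congr_fun hk x
    change k (f x) = i (g x) at this
    change r (k (f x)) = g x
    rw [this, h]

lemma exists_retraction {M N : Type u} [AddCommGroup M] [Module R M] [AddCommGroup N]
    [Module R N] [Module.Injective R M] (i : M →ₗ[R] N) (hi : Function.Injective i) :
    ∃ r : N →ₗ[R] M, ∀ x, r (i x) = x := by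
  obtain ⟨r, hr⟩ := Module.Injective.extension_property R M M N i hi LinearMap.id
  exact ⟨r, fun x => LinearMap.congr_fun hr x⟩

lemma quotient_section [IsNoetherianRing R] (W : Set (PrimeSpectrum R)) (I : Type u)
    [AddCommGroup I] [Module R I] [hI : Module.Injective R I] :
    ∃ s : (I ⧸ sectionSubmodule W I) →ₗ[R] I, ∀ x, Submodule.Quotient.mk (s x) = x := by
  have := sectionSubmodule_injective W I
  obtain ⟨r, hr⟩ := exists_retraction (sectionSubmodule W I).subtype
    (Submodule.injective_subtype _)
  let q : I →ₗ[R] I := LinearMap.id - (sectionSubmodule W I).subtype ∘ₗ r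
  refine ⟨(sectionSubmodule W I).liftQ q ?_, ?_⟩
  · intro x hx
    have := hr ⟨x, hx⟩
    change x - (r x : I) = 0
    rw [sub_eq_zero]
    exact (congrArg Subtype.val this).symm
  · intro x
    obtain ⟨x, rfl⟩ := Submodule.Quotient.mk_surjective _ x
    rw [Submodule.liftQ_apply]
    change Submodule.Quotient.mk (x - (r x : I)) = _
    rw [Submodule.Quotient.mk_sub, (Submodule.Quotient.mk_eq_zero _).mpr (r x).2, sub_zero]

lemma quotient_section_injective [IsNoetherianRing R] (W : Set (PrimeSpectrum R)) (I : Type u)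
    [AddCommGroup I] [Module R I] [hI : Module.Injective R I] :
    Module.Injective R (I ⧸ sectionSubmodule W I) := by
  obtain ⟨s, hs⟩ := quotient_section W I
  exact injective_of_retract s (sectionSubmodule W I).mkQ hs

lemma sectionSubmodule_quotient (W : Set (PrimeSpectrum R)) (I : Type u)
    [IsNoetherianRing R] [AddCommGroup I] [Module R I] [hI : Module.Injective R I] :
    sectionSubmodule W (I ⧸ sectionSubmodule W I) = ⊥ := by
  obtain ⟨s, hs⟩ := quotient_section W I
  rw [eq_bot_iff]
  intro x hx
  have : s x ∈ sectionSubmodule W I := (support_span_map_subset s x).trans hx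
  rw [Submodule.mem_bot, ← hs x]
  exact (Submodule.Quotient.mk_eq_zero _).mpr this

/-- Every submodule of an injective module has an injective hull inside that module. -/
lemma exists_injective_essential {I : Type u} [AddCommGroup I] [Module R I]
    [Module.Injective R I] (M : Submodule R I) :
    ∃ E : Submodule R I, M ≤ E ∧ Module.Injective R E ∧
      ∀ N ≤ E, N ⊓ M = ⊥ → N = ⊥ := by
  let S : Set (Submodule R I) := {E | M ≤ E ∧ ∀ N ≤ E, N ⊓ M = ⊥ → N = ⊥}
  obtain ⟨E, hME, hE⟩ := zorn_le_nonempty₀ S (by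
    intro c hc hchain E₀ hE₀
    refine ⟨sSup c, ⟨(hc hE₀).1.trans (le_sSup hE₀), ?_⟩, fun _ => le_sSup⟩
    intro N hN hNM
    rw [eq_bot_iff]
    intro x hx
    obtain ⟨F, hF, hxF⟩ := (Submodule.mem_sSup_of_directed ⟨E₀, hE₀⟩ hchain.directedOn).mp (hN hx)
    have h1 := (hc hF).2 (Submodule.span R {x}) (by simpa using hxF) (by
      rw [eq_bot_iff, ← hNM]
      exact inf_le_inf_right _ (by simpa using hx))
    simpa using h1) M ⟨le_rfl, fun N hN h => by rwa [inf_eq_left.mpr hN] at h⟩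
  -- `E` is a maximal essential extension of `M` in `I`. Taking `C` maximal with `E ⊓ C = ⊥` makes
  -- `E → I ⧸ C` essential, so the extension `h : I ⧸ C → I` of the inclusion of `E` is injective
  -- and has range essential over `M`. By maximality that range is `E`, which gives a retraction of
  -- `I` onto `E`.
  obtain ⟨C, -, hC⟩ := zorn_le_nonempty₀ {C : Submodule R I | E ⊓ C = ⊥} (by
    intro c hc hchain C₀ hC₀
    refine ⟨sSup c, ?_, fun _ => le_sSup⟩
    change E ⊓ sSup c = ⊥
    rw [eq_bot_iff]
    rintro x ⟨hxE, hx⟩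
    obtain ⟨F, hF, hxF⟩ := (Submodule.mem_sSup_of_directed ⟨C₀, hC₀⟩ hchain.directedOn).mp hx
    rw [← hc hF]
    exact ⟨hxE, hxF⟩) ⊥ (inf_bot_eq E)
  have hEC : E ⊓ C = ⊥ := hC.1
  let g : E →ₗ[R] I ⧸ C := C.mkQ ∘ₗ E.subtype
  have hg : Function.Injective g := by
    rw [injective_iff_map_eq_zero]
    intro x hx
    have : (x : I) ∈ E ⊓ C := ⟨x.2, (Submodule.Quotient.mk_eq_zero _).mp hx⟩
    rw [hEC] at this
    exact Subtype.ext this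
  have hg' (N : Submodule R (I ⧸ C)) (hN : N ⊓ LinearMap.range g = ⊥) : N = ⊥ := by
    have hCN : C ≤ N.comap C.mkQ := fun x hx => by
      rw [Submodule.mem_comap, Submodule.mkQ_apply, (Submodule.Quotient.mk_eq_zero _).mpr hx]
      exact N.zero_mem
    have h1 : E ⊓ N.comap C.mkQ = ⊥ := by
      rw [eq_bot_iff]
      rintro x ⟨hxE, hxN⟩
      have h2 : C.mkQ x ∈ N ⊓ LinearMap.range g := ⟨hxN, ⟨x, hxE⟩, rfl⟩
      rw [hN, Submodule.mem_bot] at h2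
      rw [← hEC]
      exact ⟨hxE, (Submodule.Quotient.mk_eq_zero _).mp h2⟩
    have h2 : N.comap C.mkQ ≤ C := hC.2 h1 hCN
    rw [eq_bot_iff]
    intro y hy
    obtain ⟨x, rfl⟩ := Submodule.Quotient.mk_surjective _ y
    exact (Submodule.Quotient.mk_eq_zero _).mpr (h2 hy)
  obtain ⟨h, hh⟩ := Module.Injective.extension_property R I E (I ⧸ C) g hg E.subtype
  have hh' (x : E) : h (g x) = x := LinearMap.congr_fun hh x
  have hinj : LinearMap.ker h = ⊥ := by
    refine hg' _ ?_
    rw [eq_bot_iff]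
    rintro _ ⟨hx, ⟨x, rfl⟩⟩
    have : h (g x) = 0 := hx
    rw [hh'] at this
    have : x = 0 := Subtype.ext this
    rw [this, map_zero]
    exact Submodule.zero_mem _
  have hEr : E ≤ LinearMap.range h := fun x hx => ⟨g ⟨x, hx⟩, hh' _⟩
  have hrE : LinearMap.range h ≤ E := by
    refine hE.2 ⟨hE.1.1.trans hEr, ?_⟩ hEr
    intro N hN hNM
    have h1 : N ⊓ E = ⊥ := hE.1.2 _ inf_le_right (by
      rw [eq_bot_iff, ← hNM]; exact inf_le_inf_right _ inf_le_left)
    have h2 : N.comap h = ⊥ := by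
      refine hg' _ ?_
      rw [eq_bot_iff]
      rintro _ ⟨hx, ⟨x, rfl⟩⟩
      have hx' : (x : I) ∈ N ⊓ E := ⟨by rw [← hh' x]; exact hx, x.2⟩
      rw [h1] at hx'
      have : x = 0 := Subtype.ext hx'
      rw [this, map_zero]
      exact Submodule.zero_mem _
    rw [eq_bot_iff]
    intro y hy
    obtain ⟨z, rfl⟩ := hN hy
    have : z ∈ N.comap h := hy
    rw [h2, Submodule.mem_bot] at this
    rw [this, map_zero]
    exact Submodule.zero_mem _
  refine ⟨E, hE.1.1, ?_, hE.1.2⟩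
  let r : I →ₗ[R] E := (h ∘ₗ C.mkQ).codRestrict E fun x => hrE ⟨_, rfl⟩
  exact injective_of_retract E.subtype r fun x => Subtype.ext (hh' x)

lemma IsInjectiveHull.module_injective {M : Type u} [AddCommGroup M] [Module R M]
    {E : ModuleCat.{u} R} {f : M →ₗ[R] E} (hf : IsInjectiveHull f) : Module.Injective R E := by
  have := hf.injective_module
  exact Module.injective_module_of_injective_object R E

/-- The hull of a submodule of an injective module, as a hull of an abstract module. -/
lemma exists_isInjectiveHull_le {I : Type u} [AddCommGroup I] [Module R I]
    [Module.Injective R I] {M : Type u} [AddCommGroup M] [Module R M] (f : M →ₗ[R] I)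
    (hf : Function.Injective f) :
    ∃ E : Submodule R I, ∃ g : M →ₗ[R] ModuleCat.of R E, IsInjectiveHull g ∧
      ∀ x, E.subtype (g x) = f x := by
  obtain ⟨E, hE, hinj, hess⟩ := exists_injective_essential (LinearMap.range f)
  let g : M →ₗ[R] E := f.codRestrict E fun x => hE ⟨x, rfl⟩
  refine ⟨E, g, ⟨Module.injective_object_of_injective_module R E,
    fun x y h => hf (congrArg Subtype.val h), ?_⟩, fun x => rfl⟩
  intro N hN
  have := hess (N.map E.subtype) (Submodule.map_subtype_le _ _) (by
    rw [eq_bot_iff]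
    rintro _ ⟨⟨y, hy, rfl⟩, ⟨x, hx⟩⟩
    have : y ∈ N ⊓ LinearMap.range g := ⟨hy, x, Subtype.ext hx⟩
    rw [hN] at this
    rw [(Submodule.mem_bot R).mp this, map_zero]
    exact Submodule.zero_mem _)
  rw [eq_bot_iff]
  intro y hy
  have hy' : E.subtype y ∈ N.map E.subtype := ⟨y, hy, rfl⟩
  rw [this] at hy'
  exact Subtype.ext hy'

lemma exists_isInjectiveHull (M : Type u) [AddCommGroup M] [Module R M] :
    ∃ (E : ModuleCat.{u} R) (f : M →ₗ[R] E), IsInjectiveHull f := by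
  obtain ⟨J⟩ := EnoughInjectives.presentation (ModuleCat.of R M)
  have := J.injective
  have : Module.Injective R J.J := Module.injective_module_of_injective_object R J.J
  obtain ⟨E, g, hg, -⟩ := exists_isInjectiveHull_le J.f.hom
    ((ModuleCat.mono_iff_injective _).mp J.mono)
  exact ⟨_, g, hg⟩

/-- Injective hulls of the same module are isomorphic. -/
lemma IsInjectiveHull.nonempty_iso {M : Type u} [AddCommGroup M] [Module R M]
    {E E' : ModuleCat.{u} R} {f : M →ₗ[R] E} {f' : M →ₗ[R] E'} (hf : IsInjectiveHull f)
    (hf' : IsInjectiveHull f') : Nonempty (E ≅ E') := by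
  have := hf.module_injective
  have := hf'.module_injective
  obtain ⟨h, hh⟩ := Module.Injective.extension_property R E' M E f hf.injective_map f'
  have hh' (x : M) : h (f x) = f' x := LinearMap.congr_fun hh x
  have hker : LinearMap.ker h = ⊥ := hf.essential _ (by
    rw [eq_bot_iff]
    rintro _ ⟨hx, ⟨x, rfl⟩⟩
    have : f' x = 0 := (hh' x).symm.trans hx
    rw [(injective_iff_map_eq_zero f').mp hf'.injective_map x this, map_zero]
    exact Submodule.zero_mem _)
  obtain ⟨r, hr⟩ := exists_retraction h (LinearMap.ker_eq_bot.mp hker)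
  have hker' : LinearMap.ker r = ⊥ := hf'.essential _ (by
    rw [eq_bot_iff]
    rintro _ ⟨hx, ⟨x, rfl⟩⟩
    have h1 : r (f' x) = 0 := hx
    rw [← hh', hr] at h1
    rw [← hh', h1, map_zero]
    exact Submodule.zero_mem _)
  exact ⟨(LinearEquiv.ofBijective h ⟨LinearMap.ker_eq_bot.mp hker, fun y =>
    ⟨r y, LinearMap.ker_eq_bot.mp hker' (hr _)⟩⟩).toModuleIso⟩

/-- Two nonzero summands would each meet the copy of R/p nontrivially; in a domain the two elements
found have a nonzero common multiple, which would lie in both summands. -/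
lemma IsInjectiveHull.indecomposable {p : PrimeSpectrum R} {E : ModuleCat.{u} R}
    {f : (R ⧸ p.asIdeal) →ₗ[R] E} (hf : IsInjectiveHull f) : Indecomposable E := by
  have hone : (1 : R ⧸ p.asIdeal) ≠ 0 := one_ne_zero
  refine ⟨fun h => ?_, fun Y Z e => ?_⟩
  · have := ModuleCat.subsingleton_of_isZero h
    exact hone (hf.injective_map (Subsingleton.elim _ _))
  · by_contra! hYZ
    let a : Y ⟶ E := Limits.biprod.inl ≫ e.inv
    let b : Z ⟶ E := Limits.biprod.inr ≫ e.inv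
    have key {X : ModuleCat.{u} R} (i : X ⟶ E) (hX : ¬ Limits.IsZero X) [Mono i] :
        ∃ x : X, ∃ r ∉ p.asIdeal, i.hom x = f (Ideal.Quotient.mk _ r) := by
      by_contra! hcon
      have hr : LinearMap.range i.hom = ⊥ := hf.essential _ (by
        rw [eq_bot_iff]
        rintro _ ⟨⟨x, rfl⟩, ⟨r, hr⟩⟩
        obtain ⟨r, rfl⟩ := Ideal.Quotient.mk_surjective r
        have hrp : r ∈ p.asIdeal := by
          by_contra hrp
          exact hcon x r hrp hr.symm
        rw [Submodule.mem_bot, ← hr, Ideal.Quotient.eq_zero_iff_mem.mpr hrp, map_zero])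
      have : i = 0 := ModuleCat.hom_ext (LinearMap.range_eq_bot.mp hr)
      exact hX ((Limits.IsZero.iff_id_eq_zero X).mpr (by rw [← cancel_mono i, this]; simp))
    obtain ⟨y, r, hr, hy⟩ := key a hYZ.1
    obtain ⟨z, s, hs, hz⟩ := key b hYZ.2
    have hsm (s r : R) : s • f (Ideal.Quotient.mk _ r) = f (Ideal.Quotient.mk _ (s * r)) := by
      rw [← map_smul]
      rfl
    have h1 : a.hom (s • y) = b.hom (r • z) := by
      rw [map_smul, map_smul, hy, hz, hsm, hsm, mul_comm]
    have h2 : (e.hom ≫ Limits.biprod.fst).hom (a.hom (s • y)) = s • y := by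
      change (a ≫ e.hom ≫ Limits.biprod.fst).hom _ = _
      simp [a]
    have h3 : (e.hom ≫ Limits.biprod.fst).hom (b.hom (r • z)) = 0 := by
      change (b ≫ e.hom ≫ Limits.biprod.fst).hom _ = _
      simp [b]
    have h4 : s • y = 0 := by rw [← h2, h1, h3]
    have h5 : f (Ideal.Quotient.mk _ (s * r)) = 0 := by
      rw [← hsm, ← hy, ← map_smul, h4, map_zero]
    have h6 := (injective_iff_map_eq_zero f).mp hf.injective_map _ h5
    exact (p.asIdeal.primeCompl.mul_mem hs hr) (Ideal.Quotient.eq_zero_iff_mem.mp h6)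

end Modules

/-! ### Matlis decomposition of injective modules -/

section Decomposition

variable {R : Type u} [CommRing R]

lemma injective_sup {I : Type u} [AddCommGroup I] [Module R I] {A B : Submodule R I}
    (hA : Module.Injective R A) (hB : Module.Injective R B) (h : Disjoint A B) :
    Module.Injective R (A ⊔ B : Submodule R I) := by
  obtain ⟨r, hr⟩ := exists_retraction A.subtype A.injective_subtype
  obtain ⟨s, hs⟩ := exists_retraction ((A.mkQ) ∘ₗ B.subtype) (by
    rw [injective_iff_map_eq_zero]
    intro x hx
    exact Subtype.ext (Submodule.disjoint_def.mp h x ((Submodule.Quotient.mk_eq_zero _).mp hx) x.2))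
  refine ⟨fun X Y _ _ _ _ f hf g => ?_⟩
  let b : X →ₗ[R] B := s ∘ₗ A.mkQ ∘ₗ (A ⊔ B).subtype ∘ₗ g
  let a : X →ₗ[R] A := r ∘ₗ ((A ⊔ B).subtype ∘ₗ g - B.subtype ∘ₗ b)
  obtain ⟨a', ha'⟩ := Module.Injective.extension_property R A X Y f hf a
  obtain ⟨b', hb'⟩ := Module.Injective.extension_property R B X Y f hf b
  refine ⟨Submodule.inclusion le_sup_left ∘ₗ a' + Submodule.inclusion le_sup_right ∘ₗ b',
    fun x => Subtype.ext ?_⟩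
  have h1 : a' (f x) = a x := LinearMap.congr_fun ha' x
  have h2 : b' (f x) = b x := LinearMap.congr_fun hb' x
  change (a' (f x) : I) + (b' (f x) : I) = g x
  rw [h1, h2]
  obtain ⟨y, hy, z, hz, hyz⟩ := Submodule.mem_sup.mp (g x).2
  have hb : b x = ⟨z, hz⟩ := by
    rw [← hs ⟨z, hz⟩]
    change s (A.mkQ (g x)) = s (A.mkQ z)
    rw [← hyz, map_add, Submodule.mkQ_apply, (Submodule.Quotient.mk_eq_zero _).mpr hy, zero_add]
  have ha : a x = ⟨y, hy⟩ := by
    rw [← hr ⟨y, hy⟩]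
    change r ((g x : I) - (b x : I)) = r y
    rw [hb, ← hyz, add_sub_cancel_right]
  rw [ha, hb, hyz]

lemma injective_sSup_of_finite {I : Type u} [AddCommGroup I] [Module R I]
    (S : Finset (Submodule R I)) (hS : sSupIndep (S : Set (Submodule R I)))
    (h : ∀ E ∈ S, Module.Injective R E) : Module.Injective R (sSup (S : Set (Submodule R I)) :
      Submodule R I) := by
  classical
  induction S using Finset.induction_on with
  | empty =>
    rw [Finset.coe_empty, sSup_empty]
    exact ⟨fun X Y _ _ _ _ f hf g => ⟨0, fun x => Subsingleton.elim _ _⟩⟩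
  | insert E S hES ih =>
    rw [Finset.coe_insert] at hS ⊢
    rw [sSup_insert]
    exact injective_sup (h E (Finset.mem_insert_self _ _))
      (ih (hS.mono (Set.subset_insert _ _)) fun F hF => h F (Finset.mem_insert_of_mem hF))
      (hS.disjoint_sSup (Set.mem_insert _ _) (Set.subset_insert _ _) (by simpa using hES))

/-- Over a noetherian ring, an independent sum of injective submodules is injective. -/
lemma injective_sSup [IsNoetherianRing R] {I : Type u} [AddCommGroup I] [Module R I]
    (S : Set (Submodule R I)) (hS : sSupIndep S)
    (h : ∀ E ∈ S, Module.Injective R E) : Module.Injective R (sSup S : Submodule R I) := by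
  refine Module.Baer.injective fun J g => ?_
  let N := LinearMap.range ((sSup S).subtype ∘ₗ g)
  have hN : N.FG := by
    have : N = Submodule.map ((sSup S).subtype ∘ₗ g) ⊤ := LinearMap.range_eq_map _
    rw [this]
    exact (IsNoetherian.noetherian (⊤ : Submodule R J)).map _
  -- Noetherianity makes the range of `g` finitely generated, hence compact, so it lies in a finite
  -- subsum.
  obtain ⟨T, hTS, hT⟩ := (CompleteLattice.isCompactElement_iff_exists_le_sSup_of_le_sSup _ N).mp
    ((Submodule.fg_iff_compact N).mp hN) S (by
    rintro _ ⟨x, rfl⟩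
    exact (g x).2)
  have hT' : N ≤ sSup (T : Set (Submodule R I)) := by rwa [← Finset.sup_id_eq_sSup]
  have hinj := injective_sSup_of_finite T (hS.mono hTS) fun E hE => h E (hTS hE)
  let g' : J →ₗ[R] (sSup (T : Set (Submodule R I)) : Submodule R I) :=
    ((sSup S).subtype ∘ₗ g).codRestrict _ fun x => hT' ⟨x, rfl⟩
  obtain ⟨φ, hφ⟩ := (Module.Baer.of_injective hinj) J g'
  refine ⟨Submodule.inclusion (sSup_le_sSup hTS) ∘ₗ φ, fun x hx => Subtype.ext ?_⟩
  have := congrArg Subtype.val (hφ x hx)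
  exact this

/-- Matlis: an injective module over a noetherian ring is the independent sum of injective hulls
of residue domains. -/
lemma exists_sSupIndep_isInjectiveHull [IsNoetherianRing R] (I : Type u) [AddCommGroup I]
    [Module R I] [Module.Injective R I] :
    ∃ S : Set (Submodule R I), sSupIndep S ∧ sSup S = ⊤ ∧ ∀ E ∈ S, ∃ (p : PrimeSpectrum R)
      (f : (R ⧸ p.asIdeal) →ₗ[R] ModuleCat.of R E), IsInjectiveHull f := by
  let P : Set (Submodule R I) := {E | ∃ (p : PrimeSpectrum R)
      (f : (R ⧸ p.asIdeal) →ₗ[R] ModuleCat.of R E), IsInjectiveHull f}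
  obtain ⟨S, hS⟩ := zorn_subset {S : Set (Submodule R I) | sSupIndep S ∧ S ⊆ P} (by
    intro c hc hchain
    refine ⟨⋃₀ c, ⟨?_, Set.sUnion_subset fun s hs => (hc hs).2⟩,
      fun s hs => Set.subset_sUnion_of_mem hs⟩
    rw [Set.sUnion_eq_iUnion]
    exact sSupIndep_iUnion_of_directed hchain.directed fun i => (hc i.2).1)
  refine ⟨S, hS.1.1, ?_, fun E hE => hS.1.2 hE⟩
  have hinj : Module.Injective R (sSup S : Submodule R I) := injective_sSup S hS.1.1 fun E hE => by
    obtain ⟨p, f, hf⟩ := hS.1.2 hE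
    exact hf.module_injective
  -- The sum of a maximal family is injective, so it splits off. A nonzero complement `ker r` would
  -- have an associated prime `p`, and the hull of its copy of `R ⧸ p` could be added to the family.
  obtain ⟨r, hr⟩ := exists_retraction (sSup S).subtype (sSup S).injective_subtype
  by_contra hne
  have hK : LinearMap.ker r ≠ ⊥ := fun hK => hne (by
    rw [eq_top_iff]
    intro x _
    have h1 : r (x - (r x : I)) = 0 := by
      rw [map_sub, sub_eq_zero]
      exact (hr (r x)).symm
    have h2 : x = r x := sub_eq_zero.mp (LinearMap.ker_eq_bot'.mp hK _ h1)
    rw [h2]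
    exact (r x).2)
  have hKinj : Module.Injective R (LinearMap.ker r) := by
    let q : I →ₗ[R] LinearMap.ker r := (LinearMap.id - (sSup S).subtype ∘ₗ r).codRestrict _
      fun x => by
        change r (x - (r x : I)) = 0
        rw [map_sub, sub_eq_zero]
        exact (hr (r x)).symm
    refine injective_of_retract (LinearMap.ker r).subtype q fun x => Subtype.ext ?_
    change (x : I) - (r x : I) = x
    have : r x = 0 := x.2
    rw [this]
    simp
  have : Nontrivial (LinearMap.ker r) := Submodule.nontrivial_iff_ne_bot.mpr hK
  obtain ⟨p, hp⟩ := associatedPrimes.nonempty R (LinearMap.ker r)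
  obtain ⟨hp, x, hx⟩ := isAssociatedPrime_iff.mp hp
  have hx' (a : R) : a ∈ p ↔ a • x = 0 := by
    rw [hx, Submodule.mem_colon_singleton, Submodule.mem_bot]
  let f : (R ⧸ p) →ₗ[R] LinearMap.ker r :=
    Submodule.liftQ p (LinearMap.toSpanSingleton R _ x) fun a ha => (hx' a).mp ha
  have hf : Function.Injective f := by
    rw [injective_iff_map_eq_zero]
    intro a ha
    obtain ⟨a, rfl⟩ := Submodule.Quotient.mk_surjective _ a
    exact (Submodule.Quotient.mk_eq_zero _).mpr ((hx' a).mpr ha)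
  -- The hull is formed in `I`, not inside `ker r`; by essentiality it misses `sSup S` as soon as
  -- the copy of `R ⧸ p` does.
  obtain ⟨E, g, hg, hgf⟩ := exists_isInjectiveHull_le ((LinearMap.ker r).subtype ∘ₗ f)
    ((LinearMap.ker r).injective_subtype.comp hf)
  have hEd : Disjoint E (sSup S) := by
    have h1 : (sSup S).comap E.subtype = ⊥ := hg.essential _ (by
      rw [eq_bot_iff]
      rintro _ ⟨hy, ⟨y, rfl⟩⟩
      have h2 : r (f y) = 0 := (f y).2
      have hy' : (f y : I) ∈ sSup S := by
        have : E.subtype (g y) ∈ sSup S := hy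
        rwa [hgf] at this
      have h3 := hr ⟨_, hy'⟩
      change r (f y) = _ at h3
      rw [h2] at h3
      rw [(injective_iff_map_eq_zero f).mp hf y (Subtype.ext (congrArg Subtype.val h3).symm),
        map_zero]
      exact Submodule.zero_mem _)
    rw [Submodule.disjoint_def]
    intro x hx hxS
    have : (⟨x, hx⟩ : E) ∈ (sSup S).comap E.subtype := hxS
    rw [h1] at this
    exact congrArg Subtype.val this
  have hEP : E ∈ P := ⟨⟨p, hp⟩, g, hg⟩
  have hins : insert E S ∈ {S : Set (Submodule R I) | sSupIndep S ∧ S ⊆ P} := by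
    refine ⟨?_, Set.insert_subset hEP hS.1.2⟩
    rintro A (rfl | hA)
    · refine hEd.mono_right (sSup_le_sSup ?_)
      rintro B ⟨rfl | hB, hB'⟩
      · exact (hB' rfl).elim
      · exact hB
    · have h1 : Disjoint A (sSup (S \ {A})) := hS.1.1 hA
      have h2 : Disjoint (A ⊔ sSup (S \ {A})) E :=
        hEd.symm.mono_left (sup_le (le_sSup hA) (sSup_le_sSup Set.sdiff_subset))
      refine (h1.disjoint_sup_right_of_disjoint_sup_left h2).mono_right ?_
      refine sSup_le ?_
      rintro B ⟨rfl | hB, hB'⟩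
      · exact le_sup_right
      · exact (le_sSup (show B ∈ S \ {A} from ⟨hB, hB'⟩)).trans le_sup_left
  have hES : E ∈ S := hS.2 hins (Set.subset_insert _ _) (Set.mem_insert _ _)
  have hE0 : E = ⊥ := by
    have := hEd.mono_right (le_sSup hES)
    rwa [disjoint_self] at this
  have : Nontrivial (R ⧸ p) := Ideal.Quotient.nontrivial_iff.mpr hp.ne_top
  obtain ⟨a, ha⟩ := exists_ne (0 : R ⧸ p)
  refine ha ((injective_iff_map_eq_zero f).mp hf a ?_)
  have h0 : g a = 0 := Subtype.ext (hE0.le (g a).2)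
  have h1 := hgf a
  rw [h0, map_zero] at h1
  exact Subtype.ext h1.symm

lemma exists_linearMap_of_sSupIndep {I N : Type u} [AddCommGroup I] [Module R I] [AddCommGroup N]
    [Module R N] {S : Set (Submodule R I)} (hS : sSupIndep S) (hS' : sSup S = ⊤)
    (g : ∀ E : S, E.1 →ₗ[R] N) :
    ∃ h : I →ₗ[R] N, ∀ (E : S) (x : E.1), h x = g E x := by
  classical
  have hint : DirectSum.IsInternal (fun E : S => E.1) :=
    DirectSum.isInternal_submodule_of_iSupIndep_of_iSup_eq_top
      ((sSupIndep_iff S).mp hS) (by rw [← sSup_eq_iSup']; exact hS')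
  let e := LinearEquiv.ofBijective (DirectSum.coeLinearMap fun E : S => E.1) hint
  refine ⟨DirectSum.toModule R S N g ∘ₗ e.symm.toLinearMap, fun E x => ?_⟩
  have : e.symm (x : I) = DirectSum.lof R S (fun E : S => E.1) E x := by
    rw [LinearEquiv.symm_apply_eq]
    exact (DirectSum.coeLinearMap_lof _ _ _).symm
  change DirectSum.toModule R S N g (e.symm x) = _
  rw [this, DirectSum.toModule_lof]

lemma linearMap_eq_of_sSup_eq_top {I N : Type u} [AddCommGroup I] [Module R I] [AddCommGroup N]
    [Module R N] {S : Set (Submodule R I)} (hS' : sSup S = ⊤)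
    {f g : I →ₗ[R] N} (h : ∀ E ∈ S, ∀ x ∈ E, f x = g x) : f = g := by
  have : (⊤ : Submodule R I) ≤ LinearMap.eqLocus f g := by
    rw [← hS']
    exact sSup_le fun E hE x hx => h E hE x hx
  exact LinearMap.ext fun x => this (Submodule.mem_top (x := x))

end Decomposition

/-! ### Morphisms to and from one-term complexes; K-injective targets -/

section Complexes

open Limits HomologicalComplex CochainComplex.HomComplex

variable {C : Type*} [Category* C] [Abelian C] [HasDerivedCategory.{w} C]

/-- Cohomology in degree n embeds in the opcycles, so `φ` extends to them by injectivity of `E`;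
precomposing with the projection from `K.X n` gives a chain map. -/
lemma exists_map_to_single (X : DerivedCategory C) (n : ℤ) {E : C} [Injective E]
    (φ : (DerivedCategory.homologyFunctor C n).obj X ⟶ E) :
    ∃ (f : X ⟶ (DerivedCategory.singleFunctor C n).obj E)
      (e : (DerivedCategory.homologyFunctor C n).obj
        ((DerivedCategory.singleFunctor C n).obj E) ≅ E),
      (DerivedCategory.homologyFunctor C n).map f ≫ e.hom = φ := by
  let K := DerivedCategory.Q.objPreimage X
  let i := DerivedCategory.Q.objObjPreimageIso X
  let φ' : K.homology n ⟶ E := (DerivedCategory.homologyFunctorFactors C n).inv.app K ≫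
    (DerivedCategory.homologyFunctor C n).map i.hom ≫ φ
  let ψ : K.X n ⟶ E := K.pOpcycles n ≫ Injective.factorThru φ' (K.homologyι n)
  let g : K ⟶ (HomologicalComplex.single C (.up ℤ) n).obj E :=
    mkHomToSingle ψ (fun k _ => by simp [ψ])
  suffices h : ∃ (f : X ⟶ DerivedCategory.Q.obj ((HomologicalComplex.single C (.up ℤ) n).obj E))
      (e : (DerivedCategory.homologyFunctor C n).obj (DerivedCategory.Q.obj
        ((HomologicalComplex.single C (.up ℤ) n).obj E)) ≅ E),
      (DerivedCategory.homologyFunctor C n).map f ≫ e.hom = φ from h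
  refine ⟨i.inv ≫ DerivedCategory.Q.map g,
    (DerivedCategory.homologyFunctorFactors C n).app _ ≪≫ singleObjHomologySelfIso _ n E, ?_⟩
  have hg : homologyMap g n ≫ (singleObjHomologySelfIso (.up ℤ) n E).hom = φ' := by
    rw [← cancel_epi (K.homologyπ n), homologyπ_naturality_assoc,
      homologyπ_singleObjHomologySelfIso_hom, singleObjCyclesSelfIso_hom, cyclesMap_i_assoc]
    simp only [g, mkHomToSingle_f, ψ, Category.assoc, Iso.inv_hom_id, Category.comp_id]
    rw [← homology_π_ι_assoc, Injective.comp_factorThru]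
  have h1 := (DerivedCategory.homologyFunctorFactors_hom_naturality_assoc g n
    (singleObjHomologySelfIso (.up ℤ) n E).hom).trans (congrArg _ hg)
  rw [Functor.map_comp, Category.assoc]
  refine (congrArg _ h1).trans ?_
  have h2 : (DerivedCategory.homologyFunctorFactors C n).hom.app K ≫ φ' =
      (DerivedCategory.homologyFunctor C n).map i.hom ≫ φ :=
    Iso.hom_inv_id_app_assoc (DerivedCategory.homologyFunctorFactors C n) K _
  refine (congrArg _ h2).trans ?_
  rw [← Functor.map_comp_assoc, i.inv_hom_id, CategoryTheory.Functor.map_id,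
    Category.id_comp]

/-- For a representative vanishing below degree n, cohomology in degree n is just the cycles, and
their inclusion is a chain map. -/
lemma exists_map_from_single (X : DerivedCategory C) (n : ℤ) [X.IsGE n] :
    ∃ (A : C) (f : (DerivedCategory.singleFunctor C n).obj A ⟶ X),
      IsIso ((DerivedCategory.homologyFunctor C n).map f) := by
  obtain ⟨K, hK, ⟨i⟩⟩ := DerivedCategory.exists_iso_Q_obj_of_isGE X n
  let g : (HomologicalComplex.single C (.up ℤ) n).obj (K.cycles n) ⟶ K :=
    mkHomFromSingle (K.iCycles n) (fun k _ => by simp)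
  refine ⟨K.cycles n, DerivedCategory.Q.map g ≫ i.inv, ?_⟩
  have hc : cyclesMap g n = (singleObjCyclesSelfIso (.up ℤ) n (K.cycles n)).hom := by
    rw [← cancel_mono (K.iCycles n), cyclesMap_i, singleObjCyclesSelfIso_hom, Category.assoc]
    simp [g]
  have : IsIso (cyclesMap g n) := by rw [hc]; infer_instance
  have : IsIso (K.homologyπ n) := K.isIso_homologyπ (n - 1) n (by simp)
    ((K.isZero_of_isStrictlyGE n (n - 1) (by omega)).eq_of_src _ _)
  have : IsIso ((((HomologicalComplex.single C (.up ℤ) n).obj (K.cycles n))).homologyπ n) :=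
    isIso_homologyπ _ (n - 1) n (by simp) rfl
  have : IsIso (homologyMap g n) := by
    have h := homologyπ_naturality g n
    have : IsIso (homologyπ _ n ≫ homologyMap g n) := by rw [h]; infer_instance
    exact IsIso.of_isIso_comp_left (homologyπ _ n) _
  have : IsIso ((DerivedCategory.homologyFunctor C n).map (DerivedCategory.Q.map g)) := by
    exact (NatIso.isIso_map_iff (DerivedCategory.homologyFunctorFactors C n) g).2
      (inferInstanceAs (IsIso (homologyMap g n)))
  have : IsIso ((DerivedCategory.homologyFunctor C n).map (DerivedCategory.Q.map g) ≫
      (DerivedCategory.homologyFunctor C n).map i.inv) := inferInstance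
  rw [← Functor.map_comp] at this
  exact this

variable {K L : CochainComplex C ℤ} [L.IsKInjective]

lemma exists_Q_map_eq (f : DerivedCategory.Q.obj K ⟶ DerivedCategory.Q.obj L) :
    ∃ g : K ⟶ L, DerivedCategory.Q.map g = f := by
  obtain ⟨g, hg⟩ := (CochainComplex.IsKInjective.Qh_map_bijective
    ((HomotopyCategory.quotient _ _).obj K) L).2
      ((DerivedCategory.quotientCompQhIso C).hom.app K ≫ f ≫
        (DerivedCategory.quotientCompQhIso C).inv.app L)
  obtain ⟨g, rfl⟩ := (HomotopyCategory.quotient _ _).map_surjective g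
  refine ⟨g, ?_⟩
  rw [← cancel_epi ((DerivedCategory.quotientCompQhIso C).hom.app K),
    ← DerivedCategory.quotientCompQhIso_hom_naturality, hg]
  simp

lemma nonempty_homotopy_of_Q_map_eq_zero (g : K ⟶ L) (hg : DerivedCategory.Q.map g = 0) :
    Nonempty (Homotopy g 0) := by
  refine ⟨HomotopyCategory.homotopyOfEq _ _ ?_⟩
  apply (CochainComplex.IsKInjective.Qh_map_bijective
    ((HomotopyCategory.quotient _ _).obj K) L).1
  rw [← cancel_mono ((DerivedCategory.quotientCompQhIso C).hom.app L),
    DerivedCategory.quotientCompQhIso_hom_naturality,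
    DerivedCategory.quotientCompQhIso_hom_naturality, hg, Functor.map_zero]

lemma Q_map_eq_zero_of_homotopy {K L : CochainComplex C ℤ} {g : K ⟶ L} (h : Homotopy g 0) :
    DerivedCategory.Q.map g = 0 := by
  have : (HomotopyCategory.quotient C (.up ℤ)).map g = 0 := by
    rw [HomotopyCategory.eq_of_homotopy g 0 h, Functor.map_zero]
  rw [← cancel_epi ((DerivedCategory.quotientCompQhIso C).hom.app K),
    ← DerivedCategory.quotientCompQhIso_hom_naturality, this]
  simp

lemma eq_zero_of_forall_hom_eq_zero (h : ∀ (n : ℤ) (f : K.X n ⟶ L.X n), f = 0)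
    (f : DerivedCategory.Q.obj K ⟶ DerivedCategory.Q.obj L) : f = 0 := by
  obtain ⟨g, rfl⟩ := exists_Q_map_eq f
  have : g = 0 := by ext n; exact h n _
  rw [this, Functor.map_zero]

omit [HasDerivedCategory.{w} C] in
-- Turns vanishing of a map out of a one-term complex into a lifting problem in the abelian
-- category, which for modules can be solved one direct summand at a time.
lemma nonempty_homotopy_zero_iff {X : C} {L : CochainComplex C ℤ} {n n' : ℤ} (hn : n' + 1 = n)
    (g : (CochainComplex.singleFunctor C n).obj X ⟶ L) :
    Nonempty (Homotopy g 0) ↔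
      ∃ h : X ⟶ L.X n', h ≫ L.d n' n = (singleObjXSelf (.up ℤ) n X).inv ≫ g.f n := by
  have key : Cochain.ofHom g = Cochain.fromSingleMk
      ((singleObjXSelf (.up ℤ) n X).inv ≫ g.f n) (add_zero n) :=
    (Cochain.fromSingleEquiv (add_zero n)).injective (by
      rw [Cochain.fromSingleEquiv_fromSingleMk]
      simp [Cochain.fromSingleEquiv])
  constructor
  · rintro ⟨H⟩
    obtain ⟨z, hz⟩ := Cochain.equivHomotopy _ _ H
    obtain ⟨h, rfl⟩ := Cochain.fromSingleMk_surjective z n' (by omega)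
    rw [Cochain.δ_fromSingleMk _ _ _ n (by omega), Cochain.ofHom_zero, add_zero, key] at hz
    exact ⟨h, (Cochain.fromSingleEquiv (add_zero n)).symm.injective hz.symm⟩
  · rintro ⟨h, hh⟩
    refine ⟨(Cochain.equivHomotopy _ _).symm ⟨Cochain.fromSingleMk h (by omega), ?_⟩⟩
    rw [Cochain.δ_fromSingleMk _ _ _ n (by omega), Cochain.ofHom_zero, add_zero, key, hh]

end Complexes

/-! ### Triangulated coreflections and orthogonality -/

section Coreflection

open Limits Pretriangulated

variable {T : Type*} [Category* T] [Preadditive T] [HasZeroObject T] [HasShift T ℤ]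
  [∀ n : ℤ, (shiftFunctor T n).Additive] [Pretriangulated T]

/-- A natural transformation `ε : δ ⟶ 𝟭` exhibiting the functor `δ` as the coreflection onto its
essential image. -/
def IsCoreflection {δ : T ⥤ T} (ε : δ ⟶ 𝟭 T) : Prop :=
  ∀ (A X : T), δ.essImage A → Function.Bijective fun g : A ⟶ δ.obj X => g ≫ ε.app X

omit [Preadditive T] [HasShift T ℤ] [HasZeroObject T]
  [∀ n : ℤ, (shiftFunctor T n).Additive] [Pretriangulated T] in
lemma exists_isCoreflection (δ : T ⥤ T) {ρ : T ⥤ δ.essImage.FullSubcategory}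
    (adj : δ.essImage.ι ⊣ ρ) (e : δ ≅ ρ ⋙ δ.essImage.ι) : ∃ ε : δ ⟶ 𝟭 T, IsCoreflection ε := by
  refine ⟨e.hom ≫ adj.counit, fun A X hA => ?_⟩
  have h : (fun g : A ⟶ δ.obj X => g ≫ (e.hom ≫ adj.counit).app X) =
      (adj.homEquiv ⟨A, hA⟩ X).symm ∘ (δ.essImage.fullyFaithfulι.homEquiv
        (X := ⟨A, hA⟩) (Y := ρ.obj X)).symm ∘ (fun g : A ⟶ δ.obj X => g ≫ e.hom.app X) := by
    funext g
    exact (Category.assoc _ _ _).symm.trans (adj.homEquiv_counit (X := ⟨A, hA⟩)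
      (g := ObjectProperty.homMk (g ≫ e.hom.app X))).symm
  rw [h]
  refine (Equiv.bijective _).comp ((Equiv.bijective _).comp ⟨fun f g hfg => ?_, fun f => ?_⟩)
  · exact (cancel_mono (e.hom.app X)).mp hfg
  · exact ⟨f ≫ e.inv.app X, by simp⟩

variable {δ : T ⥤ T} {ε : δ ⟶ 𝟭 T} (hε : IsCoreflection ε)

include hε

omit [Preadditive T] [HasShift T ℤ] [HasZeroObject T]
  [∀ n : ℤ, (shiftFunctor T n).Additive] [Pretriangulated T] in
-- A section is automatically a two-sided inverse: `ε.app X ≫ s` and the identity agree after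
-- composition with `ε.app X`, which determines maps out of `δ.obj X`.
lemma IsCoreflection.isIso_of_section {X : T} (s : X ⟶ δ.obj X) (hs : s ≫ ε.app X = 𝟙 X) :
    IsIso (ε.app X) := by
  refine ⟨s, (hε _ X (δ.obj_mem_essImage X)).1 ?_, hs⟩
  exact (Category.assoc _ _ _).trans ((congrArg (ε.app X ≫ ·) hs).trans
    ((Category.comp_id _).trans (Category.id_comp _).symm))

omit [Preadditive T] [HasShift T ℤ] [HasZeroObject T]
  [∀ n : ℤ, (shiftFunctor T n).Additive] [Pretriangulated T] in
lemma IsCoreflection.isIso_app {A : T} (hA : δ.essImage A) : IsIso (ε.app A) := by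
  obtain ⟨s, hs⟩ := (hε A A hA).2 (𝟙 A)
  exact hε.isIso_of_section s hs

omit [HasShift T ℤ] [HasZeroObject T] [∀ n : ℤ, (shiftFunctor T n).Additive]
  [Pretriangulated T] in
lemma IsCoreflection.isZero_iff [δ.PreservesZeroMorphisms] (X : T) :
    IsZero (δ.obj X) ↔ ∀ (A : T), δ.essImage A → ∀ f : A ⟶ X, f = 0 := by
  constructor
  · intro h A hA f
    obtain ⟨g, rfl⟩ := (hε A X hA).2 f
    have : g = 0 := h.eq_of_tgt _ _
    simp [this]
  · intro h
    rw [IsZero.iff_id_eq_zero]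
    refine (hε _ X (δ.obj_mem_essImage X)).1 ?_
    change 𝟙 _ ≫ ε.app X = 0 ≫ ε.app X
    rw [h _ (δ.obj_mem_essImage X) (ε.app X), comp_zero, comp_zero]

omit hε [Preadditive T] [HasZeroObject T] [∀ n : ℤ, (shiftFunctor T n).Additive]
  [Pretriangulated T] in
lemma essImage_shift [δ.CommShift ℤ] {A : T} (hA : δ.essImage A) (n : ℤ) :
    δ.essImage (A⟦n⟧) := by
  obtain ⟨X, ⟨e⟩⟩ := hA
  exact ⟨X⟦n⟧, ⟨(δ.commShiftIso n).app X ≪≫ (shiftFunctor T n).mapIso e⟩⟩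

omit hε [HasZeroObject T] [Pretriangulated T] in
lemma isZero_obj_shift [δ.CommShift ℤ] {X : T} (hX : IsZero (δ.obj X))
    (n : ℤ) : IsZero (δ.obj (X⟦n⟧)) :=
  ((shiftFunctor T n).map_isZero hX).of_iso ((δ.commShiftIso n).app X)

/-- δ inverts ε_X: naturality and uniqueness of lifts give δ(ε_X) = ε_{δX}, and ε is invertible on
the image of δ. -/
lemma IsCoreflection.isZero_obj₃ [δ.CommShift ℤ] [δ.IsTriangulated] {X C : T}
    {g : X ⟶ C} {h : C ⟶ (δ.obj X)⟦(1 : ℤ)⟧}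
    (hT : Triangle.mk (ε.app X) g h ∈ distTriang T) : IsZero (δ.obj C) := by
  refine (Triangle.isZero₃_iff_isIso₁ _ (δ.map_distinguished _ hT)).mpr ?_
  change IsIso (δ.map (ε.app X))
  have h1 := hε.isIso_app (δ.obj_mem_essImage X)
  have h2 : δ.map (ε.app X) = ε.app (δ.obj X) := by
    refine (hε _ X (δ.obj_mem_essImage _)).1 ?_
    exact ε.naturality (ε.app X)
  rw [h2]
  exact h1

lemma IsCoreflection.exists_triangle [δ.CommShift ℤ] [δ.IsTriangulated] (X : T) :
    ∃ (C : T) (g : X ⟶ C) (h : C ⟶ (δ.obj X)⟦(1 : ℤ)⟧),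
      Triangle.mk (ε.app X) g h ∈ distTriang T ∧ IsZero (δ.obj C) := by
  obtain ⟨C, g, h, hT⟩ := distinguished_cocone_triangle (ε.app X)
  exact ⟨C, g, h, hT, hε.isZero_obj₃ hT⟩

/-- If X has no nonzero map to the kernel, then X → C in its coreflection triangle vanishes and ε_X
acquires a section. This description makes closure under extensions formal. -/
lemma IsCoreflection.essImage_iff [δ.CommShift ℤ] [δ.IsTriangulated] (X : T) :
    δ.essImage X ↔ ∀ (Y : T), IsZero (δ.obj Y) → ∀ f : X ⟶ Y, f = 0 := by
  constructor
  · exact fun hX Y hY f => (hε.isZero_iff Y).mp hY X hX f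
  · intro h
    obtain ⟨C, g, k, hT, hC⟩ := hε.exists_triangle X
    obtain ⟨s, hs⟩ := Triangle.coyoneda_exact₂ _ hT (𝟙 X)
      ((Category.id_comp _).trans (h C hC g))
    have := hε.isIso_of_section s hs.symm
    exact ⟨X, ⟨asIso (ε.app X)⟩⟩

lemma IsCoreflection.essImage_ext₂ [δ.CommShift ℤ] [δ.IsTriangulated] {S : Triangle T}
    (hS : S ∈ distTriang T) (h₁ : δ.essImage S.obj₁) (h₃ : δ.essImage S.obj₃) :
    δ.essImage S.obj₂ := by
  rw [hε.essImage_iff]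
  intro Y hY f
  obtain ⟨g, hg⟩ : ∃ g : S.obj₃ ⟶ Y, f = S.mor₂ ≫ g :=
    Triangle.yoneda_exact₂ _ hS f ((hε.essImage_iff _).mp h₁ Y hY _)
  exact hg.trans ((congrArg (S.mor₂ ≫ ·) ((hε.essImage_iff _).mp h₃ Y hY g)).trans comp_zero)

/-- A functor over the identity whose values are coreflections is isomorphic to the
coreflection. -/
lemma IsCoreflection.nonempty_iso [δ.CommShift ℤ] [δ.IsTriangulated] {G : T ⥤ T}
    (ε' : G ⟶ 𝟭 T) (hG : ∀ X, δ.essImage (G.obj X))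
    (hG' : ∀ X, ∃ (C : T) (g : X ⟶ C) (h : C ⟶ (G.obj X)⟦(1 : ℤ)⟧),
      Triangle.mk (ε'.app X) g h ∈ distTriang T ∧ IsZero (δ.obj C)) : Nonempty (δ ≅ G) := by
  -- The comparison is the zigzag δX ← δ(GX) → GX: the first arrow is invertible because δ kills the
  -- cone of ε'_X, the second because GX lies in the image.
  have h1 (X : T) : IsIso (δ.map (ε'.app X)) := by
    obtain ⟨C, g, h, hT, hC⟩ := hG' X
    exact (Triangle.isZero₃_iff_isIso₁ _ (δ.map_distinguished _ hT)).mp hC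
  have h2 (X : T) : IsIso (ε.app (G.obj X)) := hε.isIso_app (hG X)
  have h3 : IsIso (Functor.whiskerRight ε' δ) :=
    @NatIso.isIso_of_isIso_app _ _ _ _ _ _ (Functor.whiskerRight ε' δ) h1
  have h4 : IsIso (Functor.whiskerLeft G ε) :=
    @NatIso.isIso_of_isIso_app _ _ _ _ _ _ (Functor.whiskerLeft G ε) h2
  exact ⟨δ.leftUnitor.symm ≪≫ (asIso (Functor.whiskerRight ε' δ)).symm ≪≫
    asIso (Functor.whiskerLeft G ε) ≪≫ G.rightUnitor⟩

end Coreflection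

/-! ### Cohomology, resolutions and triangles in D⁺ -/

section Plus

open Limits Pretriangulated DerivedCategory

variable {C : Type*} [Category* C] [Abelian C] [HasDerivedCategory.{w} C]

lemma plus_isGE_iff (X : Plus C) (n : ℤ) :
    X.IsGE n ↔ ∀ i < n, IsZero ((Plus.homologyFunctor C i).obj X) :=
  (Plus.isGE_ι_obj_iff X n).symm.trans (DerivedCategory.isGE_iff _ n)

lemma isZero_iff_homology (X : Plus C) :
    IsZero X ↔ ∀ i, IsZero ((Plus.homologyFunctor C i).obj X) := by
  constructor
  · exact fun h i => (Plus.homologyFunctor C i).map_isZero h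
  · intro h
    have : IsIso (0 : X ⟶ X) := by
      rw [Plus.isIso_iff]
      intro n
      exact isIso_of_source_target_iso_zero _ (h n).isoZero (h n).isoZero
    exact IsZero.of_mono_zero X X

lemma exists_isGE (X : Plus C) : ∃ n : ℤ, X.IsGE n := by
  obtain ⟨X, n, hn⟩ := X
  exact ⟨n, (Plus.isGE_ι_obj_iff _ n).mp hn⟩

lemma exists_lowest_homology {X : Plus C} (hX : ¬ IsZero X) :
    ∃ m : ℤ, X.IsGE m ∧ ¬ IsZero ((Plus.homologyFunctor C m).obj X) := by
  obtain ⟨n, hn⟩ := exists_isGE X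
  by_contra! h
  refine hX ((isZero_iff_homology X).mpr fun i => ?_)
  have key (k : ℕ) : X.IsGE (n + k) := by
    induction k with
    | zero => simpa using hn
    | succ k ih =>
      rw [plus_isGE_iff] at ih ⊢
      intro i hi
      by_cases hi' : i = n + k
      · subst hi'
        exact h _ ((plus_isGE_iff X _).mpr ih)
      · exact ih i (by push_cast at hi; lia)
  exact (plus_isGE_iff X _).mp (key (i + 1 - n).toNat) i (by lia)

/-- The homology of a shift. -/
lemma nonempty_homology_shift_iso (X : Plus C) (a n m : ℤ) (h : a + n = m) :
    Nonempty ((Plus.homologyFunctor C n).obj (X⟦a⟧) ≅ (Plus.homologyFunctor C m).obj X) :=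
  ⟨(DerivedCategory.homologyFunctor C n).mapIso ((Plus.ι.commShiftIso a).app X) ≪≫
    ((DerivedCategory.homologyFunctor C 0).shiftIso a n m h).app X.obj⟩

lemma homology_exact {T : Triangle (Plus C)} (hT : T ∈ distTriang (Plus C)) (n : ℤ) :
    (ShortComplex.mk ((Plus.homologyFunctor C n).map T.mor₁)
      ((Plus.homologyFunctor C n).map T.mor₂) (by
        rw [← Functor.map_comp, comp_distTriang_mor_zero₁₂ _ hT, Functor.map_zero])).Exact :=
  (Plus.homologyFunctor C n).map_distinguished_exact T hT

/-- The homology of a module placed in degree `n`. -/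
lemma nonempty_homology_single_iso (A : C) (n : ℤ) :
    Nonempty ((Plus.homologyFunctor C n).obj ((Plus.singleFunctor C n).obj A) ≅ A) :=
  ⟨(DerivedCategory.homologyFunctorFactors C n).app
    ((HomologicalComplex.single C (.up ℤ) n).obj A) ≪≫
      HomologicalComplex.singleObjHomologySelfIso _ n A⟩

lemma isZero_homology_single (A : C) {n i : ℤ} (h : i ≠ n) :
    IsZero ((Plus.homologyFunctor C i).obj ((Plus.singleFunctor C n).obj A)) := by
  rcases lt_or_gt_of_ne h with h | h
  · exact Plus.isZero_homology_of_isGE _ n i h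
  · exact Plus.isZero_homology_of_isLE _ n i h

lemma nonempty_single_shift_iso (A : C) (a n m : ℤ) (h : n + m = a) :
    Nonempty (((Plus.singleFunctor C a).obj A)⟦n⟧ ≅ (Plus.singleFunctor C m).obj A) :=
  ⟨((Plus.singleFunctors C).shiftIso n m a h).app A⟩

lemma plus_exists_map_to_single (X : Plus C) (n : ℤ) {E : C} [Injective E]
    (φ : (Plus.homologyFunctor C n).obj X ⟶ E) :
    ∃ (f : X ⟶ (Plus.singleFunctor C n).obj E)
      (e : (Plus.homologyFunctor C n).obj ((Plus.singleFunctor C n).obj E) ≅ E),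
      (Plus.homologyFunctor C n).map f ≫ e.hom = φ := by
  obtain ⟨f, e, h⟩ := exists_map_to_single X.obj n φ
  exact ⟨ObjectProperty.homMk f, e, h⟩

lemma plus_exists_map_from_single (X : Plus C) (n : ℤ) [X.IsGE n] :
    ∃ (A : C) (f : (Plus.singleFunctor C n).obj A ⟶ X),
      IsIso ((Plus.homologyFunctor C n).map f) := by
  have : X.obj.IsGE n := (Plus.isGE_ι_obj_iff X n).mpr inferInstance
  obtain ⟨A, f, h⟩ := exists_map_from_single X.obj n
  exact ⟨A, ObjectProperty.homMk f, h⟩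

/-- Injective resolutions of objects of the bounded below derived category. -/
lemma exists_injective_iso [EnoughInjectives C] (X : Plus C) :
    ∃ K : CochainComplex.Plus C, (∀ i, Injective (K.obj.X i)) ∧ K.obj.IsKInjective ∧
      Nonempty (X ≅ Plus.Q.obj K) := by
  obtain ⟨n, hn⟩ := exists_isGE X
  obtain ⟨L, hL, ⟨e⟩⟩ := Plus.exists_injective_nonempty_iso X n
  refine ⟨(InjectiveObject.ι C).mapCochainComplexPlus.obj L, fun i => ?_, ?_, ⟨e.symm⟩⟩
  · exact inferInstanceAs (Injective (L.obj.X i).obj)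
  · exact inferInstanceAs (CochainComplex.IsKInjective
      (((InjectiveObject.ι C).mapHomologicalComplex (.up ℤ)).obj L.obj))

lemma plus_eq_zero_of_forall_hom_eq_zero {K L : CochainComplex.Plus C} [L.obj.IsKInjective]
    (h : ∀ (n : ℤ) (f : K.obj.X n ⟶ L.obj.X n), f = 0) (f : Plus.Q.obj K ⟶ Plus.Q.obj L) :
    f = 0 :=
  ObjectProperty.hom_ext _ (eq_zero_of_forall_hom_eq_zero (K := K.obj) (L := L.obj) h f.hom)

/-- Morphisms from an object in degree `n` to a K-injective complex vanish if all morphisms to its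
term of degree `n` vanish. -/
lemma single_eq_zero_of_forall_hom_eq_zero {A : C} {n : ℤ} {L : CochainComplex.Plus C}
    [L.obj.IsKInjective] (h : ∀ f : A ⟶ L.obj.X n, f = 0)
    (f : (Plus.singleFunctor C n).obj A ⟶ Plus.Q.obj L) : f = 0 := by
  refine ObjectProperty.hom_ext _ (eq_zero_of_forall_hom_eq_zero
    (K := (HomologicalComplex.single C (.up ℤ) n).obj A) (L := L.obj) (fun i g => ?_) f.hom)
  by_cases hi : i = n
  · subst hi
    exact (cancel_epi (HomologicalComplex.singleObjXSelf (.up ℤ) i A).inv).mp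
      ((h _).trans comp_zero.symm)
  · exact (HomologicalComplex.isZero_single_obj_X _ _ _ _ hi).eq_of_src _ _

/-- The distinguished triangle attached to a short exact sequence of bounded below complexes. -/
lemma exists_distinguished_of_shortExact {K L M : CochainComplex.Plus C} (f : K ⟶ L) (g : L ⟶ M)
    (w : f.hom ≫ g.hom = 0) (hS : (ShortComplex.mk f.hom g.hom w).ShortExact) :
    ∃ h : Plus.Q.obj M ⟶ (Plus.Q.obj K)⟦(1 : ℤ)⟧,
      Triangle.mk (Plus.Q.map f) (Plus.Q.map g) h ∈ distTriang (Plus C) := by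
  let c : (Plus.Q.obj M).obj ⟶ (Plus.ι.obj (Plus.Q.obj K))⟦(1 : ℤ)⟧ := triangleOfSESδ hS
  refine ⟨ObjectProperty.homMk (c ≫ (Plus.ι.commShiftIso (1 : ℤ)).inv.app (Plus.Q.obj K)), ?_⟩
  rw [← Plus.ι.map_distinguished_iff]
  refine isomorphic_distinguished _ (triangleOfSES_distinguished hS) _ ?_
  refine Triangle.isoMk _ _ (Iso.refl _) (Iso.refl _) (Iso.refl _) ?_ ?_ ?_
  · exact (Category.comp_id _).trans (Category.id_comp _).symm
  · exact (Category.comp_id _).trans (Category.id_comp _).symm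
  · refine (congrArg _ (CategoryTheory.Functor.map_id _ _)).trans ((Category.comp_id _).trans ?_)
    refine Eq.trans ?_ (Category.id_comp _).symm
    refine (Category.assoc _ _ _).trans ?_
    exact (congrArg (c ≫ ·) ((Plus.ι.commShiftIso (1 : ℤ)).inv_hom_id_app _)).trans
      (Category.comp_id c)

end Plus

/-! ### Products of uniformly bounded below objects -/

section Products

open Limits Pretriangulated DerivedCategory

variable {C : Type*} [Category* C] [Abelian C] [HasDerivedCategory.{w} C]

/-- A sequence of objects of the derived category that is uniformly bounded below consists of
retracts of a single object. -/
lemma exists_common_retract [HasProductsOfShape ℕ C] (X : ℕ → Plus C) (a : ℤ)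
    (hX : ∀ n, (X n).IsGE a) :
    ∃ P : Plus C, ∀ n, ∃ (i : X n ⟶ P) (r : P ⟶ X n), i ≫ r = 𝟙 (X n) := by
  classical
  have h (n : ℕ) : ∃ (K : CochainComplex C ℤ) (_ : K.IsStrictlyGE a),
      Nonempty ((X n).obj ≅ Q.obj K) := by
    have : (X n).obj.IsGE a := (Plus.isGE_ι_obj_iff (X n) a).mpr (hX n)
    exact exists_iso_Q_obj_of_isGE _ a
  choose K hK e using h
  -- The `K n` vanish below a common degree, so their product of complexes is again bounded below.
  -- Inclusions and projections already exist at the level of complexes, so exactness of products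
  -- plays no role.
  let P : CochainComplex C ℤ := ∏ᶜ K
  have hP : P.IsStrictlyGE a := by
    rw [CochainComplex.isStrictlyGE_iff]
    intro i hi
    rw [IsZero.iff_id_eq_zero]
    exact (isLimitOfPreserves (HomologicalComplex.eval _ _ i) (productIsProduct K)).hom_ext
      (fun j => ((K j.as).isZero_of_isStrictlyGE a i).eq_of_tgt _ _)
  refine ⟨Plus.Q.obj ⟨P, a, hP⟩, fun n => ?_⟩
  obtain ⟨e⟩ := e n
  let i : K n ⟶ P := Pi.lift fun m => if hm : n = m then eqToHom (by rw [hm]) else 0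
  have hi : i ≫ Pi.π K n = 𝟙 (K n) := by simp [i]
  refine ⟨ObjectProperty.homMk (e.hom ≫ Q.map i), ObjectProperty.homMk (Q.map (Pi.π K n) ≫ e.inv),
    ObjectProperty.hom_ext _ ?_⟩
  change (e.hom ≫ Q.map i) ≫ (Q.map (Pi.π K n) ≫ e.inv) = 𝟙 _
  rw [Category.assoc, ← Functor.map_comp_assoc, hi]
  simp

end Products

/-! ### Maps out of a direct sum placed in one degree -/

section Single

variable {C : Type*} [Category* C] [Abelian C]

lemma single_map_f_comp {A B Z : C} {n : ℤ} (f : A ⟶ B)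
    (t : ((HomologicalComplex.single C (.up ℤ) n).obj B).X n ⟶ Z) :
    (HomologicalComplex.singleObjXSelf (.up ℤ) n A).inv ≫
      ((HomologicalComplex.single C (.up ℤ) n).map f).f n ≫ t =
      f ≫ (HomologicalComplex.singleObjXSelf (.up ℤ) n B).inv ≫ t := by
  rw [HomologicalComplex.single_map_f_self]
  simp

end Single

section Modules

open Limits Pretriangulated DerivedCategory

variable {R : Type u} [CommRing R] [HasDerivedCategory.{w} (ModuleCat.{u} R)]

/-- A map out of a sum of submodules placed in a single degree vanishes if it vanishes on all
summands. -/
lemma single_eq_zero_of_sSupIndep {I : Type u} [AddCommGroup I] [Module R I]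
    {S : Set (Submodule R I)} (hS : sSupIndep S) (hS' : sSup S = ⊤) {n : ℤ}
    {Y : Plus (ModuleCat.{u} R)}
    (h : ∀ E ∈ S, ∀ f : (Plus.singleFunctor (ModuleCat.{u} R) n).obj (ModuleCat.of R E) ⟶ Y, f = 0)
    (f : (Plus.singleFunctor (ModuleCat.{u} R) n).obj (ModuleCat.of R I) ⟶ Y) : f = 0 := by
  obtain ⟨L, _, hL, ⟨e⟩⟩ := exists_injective_iso Y
  suffices h0 : ∀ f : (Plus.singleFunctor (ModuleCat.{u} R) n).obj (ModuleCat.of R I) ⟶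
      Plus.Q.obj L, f = 0 from (cancel_mono e.hom).mp ((h0 _).trans zero_comp.symm)
  clear f
  intro f
  obtain ⟨g, hg⟩ := exists_Q_map_eq (K := (CochainComplex.singleFunctor _ n).obj (ModuleCat.of R I))
    (L := L.obj) f.hom
  refine ObjectProperty.hom_ext _ (hg.symm.trans ?_)
  let ι (E : S) : ModuleCat.of R E.1 ⟶ ModuleCat.of R I := ModuleCat.ofHom E.1.subtype
  -- On each summand a null-homotopy is a single linear map to `L.obj.X (n - 1)`, so arbitrary
  -- choices glue to a null-homotopy on the whole sum.
  have hE (E : S) : ∃ h : ModuleCat.of R E.1 ⟶ L.obj.X (n - 1), h ≫ L.obj.d (n - 1) n =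
      ι E ≫ (HomologicalComplex.singleObjXSelf (.up ℤ) n (ModuleCat.of R I)).inv ≫ g.f n := by
    have h1 : Q.map ((CochainComplex.singleFunctor _ n).map (ι E) ≫ g) = 0 := by
      have h2 := h E.1 E.2 (((Plus.singleFunctor (ModuleCat.{u} R) n).map (ι E) ≫ f) ≫ e.inv)
      have h3 : (Plus.singleFunctor (ModuleCat.{u} R) n).map (ι E) ≫ f = 0 :=
        (cancel_mono e.inv).mp (h2.trans zero_comp.symm)
      rw [Functor.map_comp, hg]
      exact congrArg (·.hom) h3
    obtain ⟨k, hk⟩ := (nonempty_homotopy_zero_iff (by lia : n - 1 + 1 = n) _).mp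
      (nonempty_homotopy_of_Q_map_eq_zero _ h1)
    refine ⟨k, hk.trans ?_⟩
    exact single_map_f_comp (ι E) (g.f n)
  choose k hk using hE
  obtain ⟨k', hk'⟩ := exists_linearMap_of_sSupIndep hS hS' fun E => (k E).hom
  obtain ⟨H⟩ := (nonempty_homotopy_zero_iff (by lia : n - 1 + 1 = n) g).mpr
    ⟨ModuleCat.ofHom k', by
      ext1
      refine linearMap_eq_of_sSup_eq_top hS' fun E hE x hx => ?_
      have h4 := congrArg (fun φ => φ.hom ⟨x, hx⟩) (hk ⟨E, hE⟩)
      refine Eq.trans ?_ h4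
      exact congrArg (L.obj.d (n - 1) n).hom (hk' ⟨E, hE⟩ ⟨x, hx⟩)⟩
  exact Q_map_eq_zero_of_homotopy H

end Modules

/-! ### The exact sequence Γ_W K → K → K/Γ_W K -/

section SectionComplex

open Limits Pretriangulated DerivedCategory

variable {R : Type u} [CommRing R] (W : Set (PrimeSpectrum R))

/-- The quotient functor `M ↦ M / Γ_W(M)`. -/
def sectionQuotientFunctor : ModuleCat.{u} R ⥤ ModuleCat.{u} R where
  obj M := ModuleCat.of R (M ⧸ sectionSubmodule W M)
  map f := ModuleCat.ofHom (Submodule.mapQ _ _ f.hom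
    fun x hx => (support_span_map_subset f.hom x).trans hx)
  map_id M := by
    ext x
    rfl
  map_comp f g := by
    ext x
    rfl

instance : (sectionQuotientFunctor W).Additive where
  map_add {M N f g} := by
    ext x
    obtain ⟨x, rfl⟩ := Submodule.mkQ_surjective _ x
    rfl

/-- The inclusion of the section functor in the identity functor. -/
def sectionInclusion : sectionFunctor W ⟶ 𝟭 (ModuleCat.{u} R) where
  app M := ModuleCat.ofHom (sectionSubmodule W M).subtype

/-- The projection from the identity functor to the quotient by the section functor. -/
def sectionProjection : 𝟭 (ModuleCat.{u} R) ⟶ sectionQuotientFunctor W where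
  app M := ModuleCat.ofHom (sectionSubmodule W M).mkQ

/-- The inclusion of the subcomplex of sections in a bounded below complex. -/
def sectionComplexInclusion (K : CochainComplex.Plus (ModuleCat.{u} R)) :
    (sectionFunctor W).mapCochainComplexPlus.obj K ⟶ K :=
  ObjectProperty.homMk
    { f := fun i => (sectionInclusion W).app (K.obj.X i)
      comm' := fun i j _ => ((sectionInclusion W).naturality (K.obj.d i j)).symm }

/-- The projection of a bounded below complex to the quotient by the subcomplex of sections. -/
def sectionComplexProjection (K : CochainComplex.Plus (ModuleCat.{u} R)) :
    K ⟶ (sectionQuotientFunctor W).mapCochainComplexPlus.obj K :=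
  ObjectProperty.homMk
    { f := fun i => (sectionProjection W).app (K.obj.X i)
      comm' := fun i j _ => ((sectionProjection W).naturality (K.obj.d i j)).symm }

lemma exists_sectionComplex_distinguished [HasDerivedCategory.{w} (ModuleCat.{u} R)]
    (K : CochainComplex.Plus (ModuleCat.{u} R)) :
    ∃ h : Plus.Q.obj ((sectionQuotientFunctor W).mapCochainComplexPlus.obj K) ⟶
        (Plus.Q.obj ((sectionFunctor W).mapCochainComplexPlus.obj K))⟦(1 : ℤ)⟧,
      Triangle.mk (Plus.Q.map (sectionComplexInclusion W K))
        (Plus.Q.map (sectionComplexProjection W K)) h ∈ distTriang _ := by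
  have zero (M : ModuleCat.{u} R) :
      (sectionInclusion W).app M ≫ (sectionProjection W).app M = 0 := by
    ext x
    exact (Submodule.Quotient.mk_eq_zero _).mpr x.2
  refine exists_distinguished_of_shortExact _ _ ?_ ?_
  · ext1 i
    exact zero _
  · refine HomologicalComplex.shortExact_of_degreewise_shortExact _ fun i => ?_
    have hm : Mono ((sectionInclusion W).app (K.obj.X i)) :=
      (ModuleCat.mono_iff_injective _).mpr Subtype.val_injective
    have he : Epi ((sectionProjection W).app (K.obj.X i)) :=
      (ModuleCat.epi_iff_surjective _).mpr (Submodule.mkQ_surjective _)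
    exact @ShortComplex.ShortExact.mk _ _ _
      (ShortComplex.mk ((sectionInclusion W).app (K.obj.X i))
        ((sectionProjection W).app (K.obj.X i)) (zero _))
      (by
        rw [ShortComplex.moduleCat_exact_iff]
        intro x hx
        exact ⟨⟨x, (Submodule.Quotient.mk_eq_zero _).mp hx⟩, rfl⟩) hm he

end SectionComplex

/-! ### The counit of RΓ_W and its cone -/

section DerivedSections

open Limits Pretriangulated DerivedCategory

variable {R : Type u} [CommRing R] [HasDerivedCategory.{w} (ModuleCat.{u} R)]
  (W : Set (PrimeSpectrum R))

/-- The inclusion of sections on the bounded below homotopy category. -/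
noncomputable def sectionHomotopyInclusion :
    (sectionFunctor.{u} W).mapHomotopyCategoryPlus ⟶
      𝟭 (HomotopyCategory.Plus (ModuleCat.{u} R)) where
  app K := ObjectProperty.homMk ((HomotopyCategory.quotient _ _).map
    (X := ((sectionFunctor W).mapHomologicalComplex _).obj K.obj.as) (Y := K.obj.as)
    { f := fun i => (sectionInclusion W).app (K.obj.as.X i)
      comm' := fun i j _ => ((sectionInclusion W).naturality (K.obj.as.d i j)).symm })
  naturality K L f := by
    obtain ⟨f⟩ := f
    obtain ⟨g, rfl⟩ := (HomotopyCategory.quotient _ _).map_surjective (X := K.obj.as)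
      (Y := L.obj.as) f
    refine ObjectProperty.hom_ext _ ?_
    refine ((HomotopyCategory.quotient _ _).map_comp
      (((sectionFunctor W).mapHomologicalComplex _).map g) _).symm.trans
      (Eq.trans ?_ ((HomotopyCategory.quotient _ _).map_comp _ g))
    congr 1

/-- The canonical morphism from derived sections to the identity functor. -/
noncomputable def derivedSectionCounit : derivedSectionFunctor W ⟶ 𝟭 (Plus (ModuleCat.{u} R)) :=
  (sectionFunctor W).rightDerivedFunctorPlus.rightDerivedDesc
    (sectionFunctor W).rightDerivedFunctorPlusUnit
    (HomotopyCategory.Plus.quasiIso _) (𝟭 _)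
    (Functor.whiskerRight (sectionHomotopyInclusion W) Plus.Qh)

end DerivedSections

section DerivedSections

open Limits Pretriangulated DerivedCategory

/-- Replacing the first two objects of a distinguished triangle by isomorphic ones. -/
lemma exists_distinguished_of_iso {T : Type*} [Category* T] [Preadditive T] [HasZeroObject T]
    [HasShift T ℤ] [∀ n : ℤ, (shiftFunctor T n).Additive] [Pretriangulated T]
    {A B C A' B' : T} {f : A ⟶ B} {g : B ⟶ C} {h : C ⟶ A⟦(1 : ℤ)⟧}
    (hT : Triangle.mk f g h ∈ distTriang T) (f' : A' ⟶ B') (a : A ≅ A') (b : B ≅ B')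
    (w : f ≫ b.hom = a.hom ≫ f') :
    ∃ (g' : B' ⟶ C) (h' : C ⟶ A'⟦(1 : ℤ)⟧), Triangle.mk f' g' h' ∈ distTriang T := by
  refine ⟨b.inv ≫ g, h ≫ a.hom⟦1⟧', isomorphic_distinguished _ hT _ ?_⟩
  refine (Triangle.isoMk (Triangle.mk f g h) (Triangle.mk f' (b.inv ≫ g) (h ≫ a.hom⟦1⟧')) a b
    (Iso.refl _) w ?_ ?_).symm
  · exact (Category.comp_id g).trans (b.hom_inv_id_assoc g).symm
  · exact (Category.id_comp (h ≫ a.hom⟦1⟧')).symm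

variable {R : Type u} [CommRing R] [HasDerivedCategory.{w} (ModuleCat.{u} R)]
  (W : Set (PrimeSpectrum R))

/-- On a bounded below complex K of injectives the unit Γ_W K → RΓ_W K is invertible, and through it
the counit becomes the inclusion Γ_W K → K, with cone K/Γ_W K. -/
lemma exists_derivedSectionCounit_triangle (X : Plus (ModuleCat.{u} R)) :
    ∃ K : CochainComplex.Plus (ModuleCat.{u} R), (∀ i, Injective (K.obj.X i)) ∧
      Nonempty ((derivedSectionFunctor W).obj X ≅
        Plus.Q.obj ((sectionFunctor W).mapCochainComplexPlus.obj K)) ∧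
      ∃ (g : X ⟶ Plus.Q.obj ((sectionQuotientFunctor W).mapCochainComplexPlus.obj K))
        (h : Plus.Q.obj ((sectionQuotientFunctor W).mapCochainComplexPlus.obj K) ⟶
          ((derivedSectionFunctor W).obj X)⟦(1 : ℤ)⟧),
        Triangle.mk ((derivedSectionCounit W).app X) g h ∈ distTriang _ := by
  obtain ⟨n, hn⟩ := exists_isGE X
  obtain ⟨L, hL, ⟨e⟩⟩ := Plus.exists_injective_nonempty_iso X n
  let K := (InjectiveObject.ι _).mapCochainComplexPlus.obj L
  let u : Plus.Q.obj ((sectionFunctor W).mapCochainComplexPlus.obj K) ⟶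
      (derivedSectionFunctor W).obj (Plus.Q.obj K) :=
    (sectionFunctor W).rightDerivedFunctorPlusUnit.app
      ((HomotopyCategory.Plus.quotient (ModuleCat.{u} R)).obj K)
  have hu : IsIso u := inferInstanceAs (IsIso
    ((sectionFunctor W).rightDerivedFunctorPlusUnit.app
      ((HomotopyCategory.Plus.quotient (ModuleCat.{u} R)).obj
        ((InjectiveObject.ι _).mapCochainComplexPlus.obj L))))
  have fac : u ≫ (derivedSectionCounit W).app (Plus.Q.obj K) =
      Plus.Q.map (sectionComplexInclusion W K) :=
    (sectionFunctor W).rightDerivedFunctorPlus.rightDerived_fac_app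
      (sectionFunctor W).rightDerivedFunctorPlusUnit (HomotopyCategory.Plus.quasiIso _) _ _ _
  obtain ⟨h, hT⟩ := exists_sectionComplex_distinguished W K
  let a := asIso u ≪≫ (derivedSectionFunctor W).mapIso e
  refine ⟨K, fun i => inferInstanceAs (Injective (L.obj.X i).obj), ⟨a.symm⟩,
    exists_distinguished_of_iso hT _ a e ?_⟩
  refine (congrArg (· ≫ e.hom) fac.symm).trans ?_
  refine (Category.assoc _ _ _).trans (Eq.trans ?_ (Category.assoc _ _ _).symm)
  exact congrArg (u ≫ ·) ((derivedSectionCounit W).naturality e.hom).symm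

end DerivedSections

/-! ### Objects with cohomology supported in W -/

section Torsion

open Limits Pretriangulated DerivedCategory

variable {R : Type u} [CommRing R]

lemma support_subset_of_iso {W : Set (PrimeSpectrum R)} {M N : ModuleCat.{u} R} (e : M ≅ N)
    (h : Module.support R M ⊆ W) : Module.support R N ⊆ W :=
  (LinearEquiv.support_eq e.toLinearEquiv).symm.subset.trans h

lemma support_subset_of_isZero {W : Set (PrimeSpectrum R)} {M : ModuleCat.{u} R} (h : IsZero M) :
    Module.support R M ⊆ W := by
  have := ModuleCat.subsingleton_of_isZero h
  rw [Module.support_eq_empty]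
  exact Set.empty_subset _

/-- A module supported in `W` embeds in an injective module supported in `W`. -/
lemma exists_mono_injective_support_subset [IsNoetherianRing R] {W : Set (PrimeSpectrum R)}
    (M : ModuleCat.{u} R) (hM : Module.support R M ⊆ W) :
    ∃ (E : ModuleCat.{u} R) (f : M ⟶ E), Injective E ∧ Module.support R E ⊆ W ∧ Mono f := by
  obtain ⟨J⟩ := EnoughInjectives.presentation M
  have := J.injective
  have : Module.Injective R J.J := Module.injective_module_of_injective_object R J.J
  have := sectionSubmodule_injective W J.J
  refine ⟨ModuleCat.of R (sectionSubmodule W J.J),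
    ModuleCat.ofHom (J.f.hom.codRestrict _ (map_mem_sectionSubmodule J.f.hom hM)),
    Module.injective_object_of_injective_module R _, support_sectionSubmodule_subset W _, ?_⟩
  rw [ModuleCat.mono_iff_injective]
  intro x y hxy
  exact (ModuleCat.mono_iff_injective _).mp J.mono (congrArg Subtype.val hxy)

variable [HasDerivedCategory.{w} (ModuleCat.{u} R)] (W : Set (PrimeSpectrum R))

/-- The objects of the bounded below derived category with cohomology supported in `W`. -/
def HasSupportIn (X : Plus (ModuleCat.{u} R)) : Prop :=
  ∀ i : ℤ, Module.support R ((Plus.homologyFunctor (ModuleCat.{u} R) i).obj X) ⊆ W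

variable {W} {X Y : Plus (ModuleCat.{u} R)}

lemma HasSupportIn.of_iso (hX : HasSupportIn W X) (e : X ≅ Y) : HasSupportIn W Y :=
  fun i => support_subset_of_iso ((Plus.homologyFunctor _ i).mapIso e) (hX i)

lemma HasSupportIn.shift (hX : HasSupportIn W X) (n : ℤ) : HasSupportIn W (X⟦n⟧) := fun i => by
  obtain ⟨e⟩ := nonempty_homology_shift_iso X n i _ rfl
  exact support_subset_of_iso e.symm (hX _)

lemma HasSupportIn.ext₂ {T : Triangle (Plus (ModuleCat.{u} R))} (hT : T ∈ distTriang _)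
    (h₁ : HasSupportIn W T.obj₁) (h₃ : HasSupportIn W T.obj₃) : HasSupportIn W T.obj₂ := fun i =>
  support_subset_of_exact_at ((ShortComplex.moduleCat_exact_iff _).mp (homology_exact hT i))
    (h₁ i) (h₃ i)

lemma HasSupportIn.ext₁ {T : Triangle (Plus (ModuleCat.{u} R))} (hT : T ∈ distTriang _)
    (h₂ : HasSupportIn W T.obj₂) (h₃ : HasSupportIn W T.obj₃) : HasSupportIn W T.obj₁ :=
  HasSupportIn.ext₂ (inv_rot_of_distTriang _ hT) (h₃.shift _) h₂

lemma HasSupportIn.ext₃ {T : Triangle (Plus (ModuleCat.{u} R))} (hT : T ∈ distTriang _)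
    (h₁ : HasSupportIn W T.obj₁) (h₂ : HasSupportIn W T.obj₂) : HasSupportIn W T.obj₃ :=
  HasSupportIn.ext₂ (rot_of_distTriang _ hT) h₂ (h₁.shift _)

lemma hasSupportIn_single {A : ModuleCat.{u} R} (hA : Module.support R A ⊆ W) (n : ℤ) :
    HasSupportIn W ((Plus.singleFunctor (ModuleCat.{u} R) n).obj A) := fun i => by
  by_cases hi : i = n
  · subst hi
    obtain ⟨e⟩ := nonempty_homology_single_iso A i
    exact support_subset_of_iso e.symm hA
  · exact support_subset_of_isZero (isZero_homology_single A hi)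

lemma HasSupportIn.support_subset {A : ModuleCat.{u} R} {n : ℤ}
    (h : HasSupportIn W ((Plus.singleFunctor (ModuleCat.{u} R) n).obj A)) :
    Module.support R A ⊆ W := by
  obtain ⟨e⟩ := nonempty_homology_single_iso A n
  exact support_subset_of_iso e (h n)

lemma hasSupportIn_Q_obj {K : CochainComplex.Plus (ModuleCat.{u} R)}
    (hK : ∀ i, Module.support R (K.obj.X i) ⊆ W) : HasSupportIn W (Plus.Q.obj K) := fun i => by
  have e : (Plus.homologyFunctor _ i).obj (Plus.Q.obj K) ≅ K.obj.homology i :=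
    (DerivedCategory.homologyFunctorFactors _ i).app K.obj
  refine support_subset_of_iso e.symm ?_
  refine (Module.support_subset_of_surjective (K.obj.homologyπ i).hom
    ((ModuleCat.epi_iff_surjective _).mp inferInstance)).trans ?_
  exact (Module.support_subset_of_injective (K.obj.iCycles i).hom
    ((ModuleCat.mono_iff_injective _).mp inferInstance)).trans (hK i)

/-- A bounded below complex of injective modules without sections with support in `W` is acyclic
if its cohomology is supported in `W`. -/
lemma HasSupportIn.isZero {K : CochainComplex.Plus (ModuleCat.{u} R)} [K.obj.IsKInjective]
    (hK : ∀ i, sectionSubmodule W (K.obj.X i) = ⊥) (h : HasSupportIn W (Plus.Q.obj K)) :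
    IsZero (Plus.Q.obj K) := by
  by_contra hne
  obtain ⟨m, hm, hm'⟩ := exists_lowest_homology hne
  -- The lowest cohomology module `A` is supported in `W`, so it has no nonzero map to `K.obj.X m`.
  -- Thus `f`, which is an isomorphism on that cohomology, is zero.
  obtain ⟨A, f, hf⟩ := plus_exists_map_from_single (Plus.Q.obj K) m
  obtain ⟨e⟩ := nonempty_homology_single_iso A m
  have hA : Module.support R A ⊆ W :=
    support_subset_of_iso ((asIso ((Plus.homologyFunctor _ m).map f)).symm ≪≫ e) (h m)
  have hf0 : f = 0 := single_eq_zero_of_forall_hom_eq_zero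
    (fun g => ModuleCat.hom_ext (eq_zero_of_support_subset g.hom hA (hK m))) f
  refine hm' ?_
  exact IsZero.of_epi_eq_zero ((Plus.homologyFunctor _ m).map f)
    ((congrArg _ hf0).trans (Functor.map_zero _ _ _))

end Torsion

/-! ### Support of the image of δ; injectives in the image -/

section Main

open Limits Pretriangulated DerivedCategory

/-- Some cyclic submodule Rx has annihilator inside q, so it maps onto R/q ⊆ E, and injectivity of E
extends this map to M. -/
lemma exists_ne_zero_to_injectiveHull {R : Type u} [CommRing R] {M : Type u} [AddCommGroup M]
    [Module R M] {q : PrimeSpectrum R} (hq : q ∈ Module.support R M) {E : ModuleCat.{u} R}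
    {f : (R ⧸ q.asIdeal) →ₗ[R] E} (hf : IsInjectiveHull f) : ∃ φ : M →ₗ[R] E, φ ≠ 0 := by
  obtain ⟨x, hx⟩ := Module.mem_support_iff'.mp hq
  have hle : LinearMap.ker (LinearMap.toSpanSingleton R M x) ≤ q.asIdeal := fun r hr => by
    by_contra hr'
    exact hx r hr' hr
  let e := (LinearMap.toSpanSingleton R M x).quotKerEquivRange
  let g : LinearMap.range (LinearMap.toSpanSingleton R M x) →ₗ[R] E :=
    f ∘ₗ Submodule.factor hle ∘ₗ e.symm.toLinearMap
  have := hf.module_injective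
  obtain ⟨φ, hφ⟩ := Module.Injective.extension_property R E _ M
    (LinearMap.range (LinearMap.toSpanSingleton R M x)).subtype (Submodule.injective_subtype _) g
  refine ⟨φ, fun h0 => ?_⟩
  have h1 := LinearMap.congr_fun hφ (e (Submodule.Quotient.mk 1))
  have h2 : g (e (Submodule.Quotient.mk 1)) = f 1 := by
    simp only [g, LinearMap.comp_apply, LinearEquiv.coe_coe, LinearEquiv.symm_apply_apply]
    rfl
  rw [h2, h0] at h1
  have h3 : (1 : R ⧸ q.asIdeal) = 0 := hf.injective_map (h1.symm.trans (map_zero f).symm)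
  exact one_ne_zero h3

variable {R : Type u} [CommRing R] [IsNoetherianRing R]
  [HasDerivedCategory.{w} (ModuleCat.{u} R)]
  {δ : Plus (ModuleCat.{u} R) ⥤ Plus (ModuleCat.{u} R)} {ε : δ ⟶ 𝟭 _}
  [δ.CommShift ℤ] [δ.IsTriangulated] {W : Set (PrimeSpectrum R)}

omit [IsNoetherianRing R] in
lemma exists_shift_ofModule_iso (E : ModuleCat.{u} R) (n : ℤ) :
    Nonempty ((ofModule E)⟦-n⟧ ≅ (Plus.singleFunctor (ModuleCat.{u} R) n).obj E) :=
  nonempty_single_shift_iso E 0 (-n) n (by lia)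

omit [IsNoetherianRing R] in
lemma IsCoreflection.hasSupportIn (hε : IsCoreflection ε)
    (hker : ∀ p ∉ W, ∀ (E : ModuleCat.{u} R) (f : (R ⧸ p.asIdeal) →ₗ[R] E),
      IsInjectiveHull f → IsZero (δ.obj (ofModule E)))
    {X : Plus (ModuleCat.{u} R)} (hX : δ.essImage X) : HasSupportIn W X := by
  intro j q hq
  by_contra hqW
  obtain ⟨E, f, hf⟩ := exists_isInjectiveHull (R := R) (R ⧸ q.asIdeal)
  obtain ⟨φ, hφ⟩ := exists_ne_zero_to_injectiveHull hq hf
  have := hf.injective_module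
  obtain ⟨g, e, hg⟩ := plus_exists_map_to_single X j (ModuleCat.ofHom φ)
  obtain ⟨i⟩ := exists_shift_ofModule_iso E j
  have hE : IsZero (δ.obj ((Plus.singleFunctor (ModuleCat.{u} R) j).obj E)) :=
    (isZero_obj_shift (hker q hqW E f hf) (-j)).of_iso (δ.mapIso i.symm)
  have hg0 : g = 0 := (hε.isZero_iff _).mp hE X hX g
  refine hφ ?_
  have h0 : (Plus.homologyFunctor _ j).map g ≫ e.hom = 0 := by
    rw [hg0, Functor.map_zero, zero_comp]
  exact congrArg ModuleCat.Hom.hom (hg.symm.trans h0)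

omit [HasDerivedCategory.{w} (ModuleCat.{u} R)] in
lemma isKInjective_sectionQuotient (K : CochainComplex.Plus (ModuleCat.{u} R))
    (hK : ∀ i, Injective (K.obj.X i)) :
    ((sectionQuotientFunctor W).mapCochainComplexPlus.obj K).obj.IsKInjective := by
  obtain ⟨n, hn⟩ := ((sectionQuotientFunctor W).mapCochainComplexPlus.obj K).property
  have (i : ℤ) : Injective
      (((sectionQuotientFunctor W).mapCochainComplexPlus.obj K).obj.X i) := by
    have : Module.Injective R (K.obj.X i) := Module.injective_module_of_injective_object R _
    have := quotient_section_injective W (K.obj.X i)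
    exact Module.injective_object_of_injective_module R (K.obj.X i ⧸ sectionSubmodule W (K.obj.X i))
  exact CochainComplex.isKInjective_of_injective _ n

omit [HasDerivedCategory.{w} (ModuleCat.{u} R)] in
lemma sectionSubmodule_sectionQuotient (K : CochainComplex.Plus (ModuleCat.{u} R))
    (hK : ∀ i, Injective (K.obj.X i)) (i : ℤ) :
    sectionSubmodule W (((sectionQuotientFunctor W).mapCochainComplexPlus.obj K).obj.X i) = ⊥ := by
  have : Module.Injective R (K.obj.X i) := Module.injective_module_of_injective_object R _
  exact sectionSubmodule_quotient W (K.obj.X i)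

/-- An object with cohomology supported in `W` has no nonzero morphism to a bounded below complex
of injective modules without sections with support in `W`. -/
lemma HasSupportIn.eq_zero {X : Plus (ModuleCat.{u} R)} (hX : HasSupportIn W X)
    {L : CochainComplex.Plus (ModuleCat.{u} R)} [L.obj.IsKInjective]
    (hL : ∀ i, sectionSubmodule W (L.obj.X i) = ⊥) (f : X ⟶ Plus.Q.obj L) : f = 0 := by
  obtain ⟨K, hK, hK', ⟨e⟩⟩ := exists_injective_iso X
  obtain ⟨h, hT⟩ := exists_sectionComplex_distinguished W K
  have hZ (i : ℤ) : Module.support R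
      (((sectionFunctor W).mapCochainComplexPlus.obj K).obj.X i) ⊆ W :=
    support_sectionSubmodule_subset W (K.obj.X i)
  have := isKInjective_sectionQuotient (W := W) K hK
  -- The quotient complex has cohomology supported in `W` but no sections there, hence is acyclic.
  -- So `X` is represented by the section complex, whose terms have no nonzero maps to those of `L`.
  have hY := HasSupportIn.isZero (sectionSubmodule_sectionQuotient K hK)
    (HasSupportIn.ext₃ hT (hasSupportIn_Q_obj hZ) (hX.of_iso e))
  have hiso : IsIso (Plus.Q.map (sectionComplexInclusion W K)) :=
    (Triangle.isZero₃_iff_isIso₁ _ hT).mp hY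
  have h1 := plus_eq_zero_of_forall_hom_eq_zero (L := L)
    (fun i g => ModuleCat.hom_ext (eq_zero_of_support_subset g.hom (hZ i) (hL i)))
    (Plus.Q.map (sectionComplexInclusion W K) ≫ e.inv ≫ f)
  exact (cancel_epi e.inv).mp (((cancel_epi (Plus.Q.map (sectionComplexInclusion W K))).mp
    (h1.trans comp_zero.symm)).trans comp_zero.symm)

lemma IsCoreflection.isZero_obj_sectionQuotient (hε : IsCoreflection ε)
    (him : ∀ X, δ.essImage X → HasSupportIn W X) (K : CochainComplex.Plus (ModuleCat.{u} R))
    (hK : ∀ i, Injective (K.obj.X i)) :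
    IsZero (δ.obj (Plus.Q.obj ((sectionQuotientFunctor W).mapCochainComplexPlus.obj K))) := by
  have := isKInjective_sectionQuotient (W := W) K hK
  exact (hε.isZero_iff _).mpr fun A hA f =>
    (him A hA).eq_zero (sectionSubmodule_sectionQuotient K hK) f

/-- Left orthogonality to the kernel of δ can be tested on the summands of a Matlis decomposition;
each R/p that occurs embeds in E, which forces p ∈ W. -/
lemma IsCoreflection.essImage_single (hε : IsCoreflection ε)
    (hhull : ∀ p ∈ W, ∀ (E : ModuleCat.{u} R) (f : (R ⧸ p.asIdeal) →ₗ[R] E),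
      IsInjectiveHull f → δ.essImage (ofModule E)) {E : ModuleCat.{u} R} [Injective E]
    (hE : Module.support R E ⊆ W) (n : ℤ) :
    δ.essImage ((Plus.singleFunctor (ModuleCat.{u} R) n).obj E) := by
  obtain ⟨i⟩ := exists_shift_ofModule_iso E n
  refine δ.essImage.prop_of_iso i (essImage_shift ?_ (-n))
  rw [hε.essImage_iff]
  intro Y hY f
  have : Module.Injective R E := Module.injective_module_of_injective_object R E
  obtain ⟨S, hS, hS', h⟩ := exists_sSupIndep_isInjectiveHull (R := R) E
  refine single_eq_zero_of_sSupIndep hS hS' (fun F hF g => ?_) f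
  obtain ⟨p, k, hk⟩ := h F hF
  have hp : p ∈ W := by
    refine hE (Module.support_subset_of_injective F.subtype F.injective_subtype
      (Module.support_subset_of_injective k hk.injective_map ?_))
    rw [Module.mem_support_iff_of_finite, Ideal.annihilator_quotient]
  exact (hε.essImage_iff _).mp (hhull p hp _ k hk) Y hY g

end Main

/-! ### The way-out argument -/

section WayOut

open Limits Pretriangulated DerivedCategory
open scoped ZeroObject

variable {R : Type u} [CommRing R] [IsNoetherianRing R]
  [HasDerivedCategory.{w} (ModuleCat.{u} R)]
  {δ : Plus (ModuleCat.{u} R) ⥤ Plus (ModuleCat.{u} R)} {ε : δ ⟶ 𝟭 _}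
  [δ.CommShift ℤ] [δ.IsTriangulated] {W : Set (PrimeSpectrum R)}

omit [IsNoetherianRing R] in
/-- The fibre of a morphism that is injective on the lowest cohomology. -/
lemma isGE_fibre {X Y Z : Plus (ModuleCat.{u} R)} {v : Z ⟶ Y} {f : Y ⟶ X} {w : X ⟶ Z⟦(1 : ℤ)⟧}
    (hT : Triangle.mk v f w ∈ distTriang _) {n : ℤ} (hX : X.IsGE n) (hY : Y.IsGE n)
    (hf : Mono ((Plus.homologyFunctor _ n).map f)) : Z.IsGE (n + 1) := by
  rw [plus_isGE_iff] at hX hY ⊢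
  intro i hi
  have hv : (Plus.homologyFunctor _ i).map v = 0 := by
    by_cases hin : i = n
    · subst hin
      have h0 : v ≫ f = 0 := comp_distTriang_mor_zero₁₂ _ hT
      rw [← cancel_mono ((Plus.homologyFunctor _ i).map f), ← Functor.map_comp, h0,
        Functor.map_zero, zero_comp]
    · exact (hY i (by lia)).eq_of_tgt _ _
  obtain ⟨e⟩ := nonempty_homology_shift_iso X (-1) i (i - 1) (by lia)
  have hz : IsZero ((Plus.homologyFunctor _ i).obj (X⟦(-1 : ℤ)⟧)) :=
    (hX (i - 1) (by lia)).of_iso e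
  have hmono : Mono ((Plus.homologyFunctor _ i).map v) :=
    (homology_exact (inv_rot_of_distTriang _ hT) i).mono_g (hz.eq_of_src _ _)
  exact IsZero.of_mono_eq_zero _ hv

/-- Each step embeds H^{a+n}(Y) in an injective module supported in W and replaces Y by the fibre of
the induced map. By the octahedral axiom the new C is an extension of the old one by a shifted
injective, so it stays in the image of δ. -/
lemma IsCoreflection.exists_approximation (hε : IsCoreflection ε)
    (hinj : ∀ (E : ModuleCat.{u} R), Injective E → Module.support R E ⊆ W → ∀ n : ℤ,
      δ.essImage ((Plus.singleFunctor (ModuleCat.{u} R) n).obj E))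
    {X : Plus (ModuleCat.{u} R)} (hX : HasSupportIn W X) {a : ℤ} (ha : X.IsGE a) (n : ℕ) :
    ∃ (Y C : Plus (ModuleCat.{u} R)) (f : Y ⟶ X) (g : X ⟶ C) (h : C ⟶ Y⟦(1 : ℤ)⟧),
      Triangle.mk f g h ∈ distTriang _ ∧ Y.IsGE (a + n) ∧ HasSupportIn W Y ∧ δ.essImage C := by
  induction n with
  | zero =>
    refine ⟨X, 0, 𝟙 X, 0, 0, contractible_distinguished X, by simpa using ha, hX, ?_⟩
    exact (hε.essImage_iff _).mpr fun Y _ f => (isZero_zero _).eq_of_src _ _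
  | succ n ih =>
    obtain ⟨Y, C, f, g, h, hT, hY, hYW, hC⟩ := ih
    obtain ⟨E, φ, hE, hEW, hφ⟩ := exists_mono_injective_support_subset _ (hYW (a + n))
    obtain ⟨k, e, hk⟩ := plus_exists_map_to_single Y (a + n) φ
    obtain ⟨Z, v, w, hT₁⟩ := distinguished_cocone_triangle₁ k
    obtain ⟨C', g', h', hT'⟩ := distinguished_cocone_triangle (v ≫ f)
    let o := Triangulated.someOctahedron rfl hT₁ hT hT'
    refine ⟨Z, C', v ≫ f, g', h', hT', ?_, ?_, ?_⟩
    · have hm : Mono ((Plus.homologyFunctor _ (a + n)).map k) := by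
        rw [← hk] at hφ
        exact mono_of_mono _ e.hom
      have := isGE_fibre hT₁ inferInstance hY hm
      push_cast
      rwa [← add_assoc]
    · exact HasSupportIn.ext₁ hT₁ hYW (hasSupportIn_single hEW _)
    · exact hε.essImage_ext₂ o.mem (hinj E hE hEW _) hC

/-- Since δX = 0, one has C_n ≅ δ(C_n) ≅ δ(Y_n)[1]. Once H^{a+1}(δ(Y_n)) vanishes, so does H^a(C_n),
and with it H^a(X), against the choice of a as the lowest nonzero degree. -/
lemma IsCoreflection.isZero_of_hasSupportIn (hε : IsCoreflection ε)
    (hinj : ∀ (E : ModuleCat.{u} R), Injective E → Module.support R E ⊆ W → ∀ n : ℤ,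
      δ.essImage ((Plus.singleFunctor (ModuleCat.{u} R) n).obj E))
    {X : Plus (ModuleCat.{u} R)} (hX : HasSupportIn W X) (hδ : IsZero (δ.obj X)) : IsZero X := by
  by_contra hne
  obtain ⟨a, ha, ha'⟩ := exists_lowest_homology hne
  choose Y C f g h hT hY _ hC using hε.exists_approximation hinj hX ha
  -- Shifting by n brings every `Y n` into degrees ≥ a, so a single lower bound b for δP places
  -- δ(Y_n) in degrees ≥ b + n.
  have hYn (n : ℕ) : ((Y n)⟦(n : ℤ)⟧).IsGE a := by
    rw [plus_isGE_iff]
    intro i hi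
    obtain ⟨e⟩ := nonempty_homology_shift_iso (Y n) n i _ rfl
    exact ((plus_isGE_iff _ _).mp (hY n) _ (by lia)).of_iso e
  obtain ⟨P, hP⟩ := exists_common_retract (fun n => (Y n)⟦(n : ℤ)⟧) a hYn
  obtain ⟨b, hb⟩ := exists_isGE (δ.obj P)
  -- Large enough that a + 1 < b + n; the final + 1 also gives n ≥ 1, so that `Y n` has no
  -- cohomology in degree a.
  let n : ℕ := (a + 1 - b).toNat + 1
  have hn : a + 1 - n < b := by lia
  obtain ⟨s, r, hsr⟩ := hP n
  have h1 : IsZero ((Plus.homologyFunctor _ (a + 1 - n)).obj (δ.obj ((Y n)⟦(n : ℤ)⟧))) := by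
    have h2 := (plus_isGE_iff _ _).mp hb _ hn
    rw [IsZero.iff_id_eq_zero]
    have h3 : (δ ⋙ Plus.homologyFunctor _ (a + 1 - n)).map s ≫
        (δ ⋙ Plus.homologyFunctor _ (a + 1 - n)).map r = 𝟙 _ := by
      rw [← Functor.map_comp, hsr, CategoryTheory.Functor.map_id]
    exact h3.symm.trans ((congrArg (· ≫ _) (h2.eq_of_tgt _ 0)).trans zero_comp)
  obtain ⟨e₁⟩ := nonempty_homology_shift_iso (δ.obj (Y n)) n (a + 1 - n) (a + 1) (by lia)
  obtain ⟨e₂⟩ := nonempty_homology_shift_iso (δ.obj (Y n)) 1 a (a + 1) (by lia)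
  have h4 : IsIso (δ.mapTriangle.obj (Triangle.mk (f n) (g n) (h n))).mor₃ :=
    (Triangle.isZero₂_iff_isIso₃ _ (δ.map_distinguished _ (hT n))).mp hδ
  have h5 := hε.isIso_app (hC n)
  have h6 : C n ≅ (δ.obj (Y n))⟦(1 : ℤ)⟧ := (asIso (ε.app (C n))).symm ≪≫
    @asIso _ _ _ _ (δ.mapTriangle.obj (Triangle.mk (f n) (g n) (h n))).mor₃ h4
  have h7 : IsZero ((Plus.homologyFunctor _ a).obj (C n)) :=
    h1.of_iso ((Plus.homologyFunctor _ a).mapIso h6 ≪≫ e₂ ≪≫ e₁.symm ≪≫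
      (Plus.homologyFunctor _ _).mapIso ((δ.commShiftIso (n : ℤ)).app (Y n)).symm)
  have h8 : IsZero ((Plus.homologyFunctor _ a).obj (Y n)) :=
    (plus_isGE_iff _ _).mp (hY n) _ (by lia)
  exact ha' ((homology_exact (hT n) a).isZero_of_both_zeros (h8.eq_of_src _ _) (h7.eq_of_tgt _ _))

/-- The cone of ε_X is supported in W and killed by δ, hence zero. -/
lemma IsCoreflection.essImage_of_hasSupportIn (hε : IsCoreflection ε)
    (him : ∀ X, δ.essImage X → HasSupportIn W X)
    (hinj : ∀ (E : ModuleCat.{u} R), Injective E → Module.support R E ⊆ W → ∀ n : ℤ,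
      δ.essImage ((Plus.singleFunctor (ModuleCat.{u} R) n).obj E))
    {X : Plus (ModuleCat.{u} R)} (hX : HasSupportIn W X) : δ.essImage X := by
  obtain ⟨C, g, h, hT, hC⟩ := hε.exists_triangle X
  have h1 := hε.isZero_of_hasSupportIn hinj
    (HasSupportIn.ext₃ hT (him _ (δ.obj_mem_essImage X)) hX) hC
  have : IsIso (ε.app X) := (Triangle.isZero₃_iff_isIso₁ _ hT).mp h1
  exact ⟨X, ⟨asIso (ε.app X)⟩⟩

end WayOut

end AbstractLocalCohomology

/-! ### The classification theorem -/

open AbstractLocalCohomology in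
theorem theorem2p10 {R : Type u} [CommRing R] [IsNoetherianRing R]
    [HasDerivedCategory.{w} (ModuleCat.{u} R)]
    (δ : DerivedCategory.Plus (ModuleCat.{u} R) ⥤ DerivedCategory.Plus (ModuleCat.{u} R))
    (hδ : AbstractLocalCohomology.IsAbstractLocalCohomologyFunctor δ) :
    ∃ W : Set (PrimeSpectrum R),
      W = {p : PrimeSpectrum R | ∃ (E : ModuleCat.{u} R) (f : (R ⧸ p.asIdeal) →ₗ[R] E),
        AbstractLocalCohomology.IsInjectiveHull f ∧
          AbstractLocalCohomology.im δ (AbstractLocalCohomology.ofModule E)} ∧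
      (∀ p q : PrimeSpectrum R, p ∈ W → p ≤ q → q ∈ W) ∧
      Nonempty (δ ≅ AbstractLocalCohomology.derivedSectionFunctor W) := by
  obtain ⟨⟨_, _, _⟩, ⟨ρ, ⟨adj⟩, ⟨e⟩⟩, hdiv⟩ := hδ
  obtain ⟨ε, hε⟩ := exists_isCoreflection δ adj e
  obtain ⟨W, hW⟩ : ∃ W, W = {p : PrimeSpectrum R | ∃ (E : ModuleCat.{u} R)
      (f : (R ⧸ p.asIdeal) →ₗ[R] E), IsInjectiveHull f ∧ im δ (ofModule E)} := ⟨_, rfl⟩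
  have hker : ∀ p ∉ W, ∀ (E : ModuleCat.{u} R) (f : (R ⧸ p.asIdeal) →ₗ[R] E),
      IsInjectiveHull f → Limits.IsZero (δ.obj (ofModule E)) := fun p hp E f hf =>
    (hdiv E hf.injective_module hf.indecomposable).resolve_left
      fun h => hp (by rw [hW]; exact ⟨E, f, hf, h⟩)
  have hhull : ∀ p ∈ W, ∀ (E : ModuleCat.{u} R) (f : (R ⧸ p.asIdeal) →ₗ[R] E),
      IsInjectiveHull f → δ.essImage (ofModule E) := fun p hp E f hf => by
    rw [hW] at hp
    obtain ⟨E', f', hf', h⟩ := hp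
    obtain ⟨i⟩ := hf'.nonempty_iso hf
    exact δ.essImage.prop_of_iso ((DerivedCategory.Plus.singleFunctor _ 0).mapIso i) h
  have him (X) (hX : δ.essImage X) : HasSupportIn W X := hε.hasSupportIn hker hX
  have hinj (E : ModuleCat.{u} R) (_ : Injective E) (hE : Module.support R E ⊆ W) (n : ℤ) :=
    hε.essImage_single hhull hE n
  refine ⟨W, hW, fun p q hp hpq => ?_, ?_⟩
  -- Since E(R/p) lies in the image, its support is contained in W; that support contains Supp(R/p)
  -- = V(p).
  · obtain ⟨E, f, hf⟩ := exists_isInjectiveHull (R := R) (R ⧸ p.asIdeal)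
    have hE : Module.support R E ⊆ W := (him _ (hhull p hp E f hf)).support_subset
    refine hE (Module.support_subset_of_injective f hf.injective_map ?_)
    rwa [Module.mem_support_iff_of_finite, Ideal.annihilator_quotient]
  · have hsec (X) : δ.essImage ((derivedSectionFunctor W).obj X) := by
      obtain ⟨K, hK, ⟨i⟩, -⟩ := exists_derivedSectionCounit_triangle W X
      exact hε.essImage_of_hasSupportIn him hinj ((hasSupportIn_Q_obj fun j =>
        support_sectionSubmodule_subset W (K.obj.X j)).of_iso i.symm)
    refine hε.nonempty_iso (derivedSectionCounit W) hsec fun X => ?_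
    obtain ⟨K, hK, -, g, h, hT⟩ := exists_derivedSectionCounit_triangle W X
    exact ⟨_, g, h, hT, hε.isZero_obj_sectionQuotient him K hK⟩
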